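/- **Setting.** Let $K$ be a number field in which $2$ is inert, $\mathcal O_2$ the completion of its ring of integers at $(2)$, $K_2$ its fraction field, $k_2=\mathcal O_2/2\mathcal O_2$, $q=\#k_2=2^r$. Let $B_2$ be a quaternion algebra over $K_2$. Write $H=\begin{pmatrix}0&1\\1&0\end{pmatrix}$, $J=\begin{pmatrix}2&1\\1&2\end{pmatrix}$, and consider the classes of ternary forms A1: $H\perp\langle 2^s\rangle$; A2: $J\perp\langle2^s\rangle$; B: $\langle1,1,\delta2^s\rangle$; C: $\langle1,6,\delta2^s\rangle$; D: $\langle1,5,\delta2^s\rangle$; E: $\langle1,2,\delta2^s\rangle$; F: $\langle1,14,\delta2^s\rangle$; G: $\langle1,10,\delta2^s\rangle$. An $\mathcal O_2$-basis $1,e_1,e_2,e_3$ of an order $R$ of $B_2$ is *good* for the form $f$ (and $R$ then corresponds to $f$) if * $f=\langle1,a,b\rangle$: $e_1^2=-ab$, $e_2^2=-b$, $e_3^2=-a$, $e_1e_2=-be_3=-e_2e_1$, $e_2e_3=-e_1=-e_3e_2$, $e_3e_1=-ae_2=-e_1e_3$; * $f=H\perp\langle t\rangle$: $e_1^2=e_2^2=0$,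 $e_3^2=e_3$, $e_1e_2=t(1-e_3)$, $e_2e_1=te_3$, $e_2e_3=0$, $e_3e_2=e_2$, $e_3e_1=0$, $e_1e_3=e_1$; * $f=J\perp\langle t\rangle$: $e_1^2=e_2^2=-t$, $e_3^2=e_3-1$, $e_1e_2=t(1-e_3)$, $e_2e_1=te_3$, $e_2e_3=-e_1$, $e_3e_2=e_1+e_2=e_1e_3$, $e_3e_1=-e_2$. A basis $1,e_1,e_2,e_3$ of $R$ is *quasi-good* for $f$ if there is a good basis $1,\tilde e_1,\tilde e_2,\tilde e_3$ of $R$ for $f$ with $\tilde e_i\equiv e_i \pmod{2R}$ for $i=1,2,3$. Let $\mu_1,\dots,\mu_{10}\in\mathcal O_2$ satisfy $\mu_1^2=-7$, $3\mu_2^2=-13$, $25\mu_3^2=1$, $9\mu_4^2=1$, $3\mu_5^2=-5$, $\mu_6^2=-15$, $3\mu_7^2=-29$, $3\mu_8^2=-533$, $15\mu_9^2=-1$, $7\mu_{10}^2=-1$. For a form $f$ and a form $g$ beneath it, elements $d_1,d_2,d_3$ are attached to $e_1,e_2,e_3$ as follows. * A1→A2, $H\perp\langle1\rangle\to J\perp\langle4\rangle$: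 $d_1=2(\mu_1-2e_1-3e_2-2\mu_1e_3)$, $d_2=2(-\mu_1+3e_1+2e_2+2\mu_1e_3)$, $d_3=-2-\mu_1e_1-\mu_1e_2+5e_3$. * A1→A1, $H\perp\langle2^s\rangle\to H\perp\langle2^{s+1}\rangle$ ($s\ge0$): $e_1,\ 2e_2,\ e_3$. * A1→B, $H\perp\langle2\rangle\to\langle1,1,3\rangle$: $\mu_1+e_1+2e_2-2\mu_1e_3$, $-5+2\mu_1e_1+\mu_1e_2+10e_3$, $\mu_1+3e_1+e_2-2\mu_1e_3$. * A2→A2, $J\perp\langle2^s\rangle\to J\perp\langle2^{s+2}\rangle$ ($s\ge1$): $2e_1,\ 2e_2,\ e_3$. * A2→B, $J\perp\langle2\rangle\to\langle1,1,1\rangle$: $\mu_2-e_1+2e_2-2\mu_2e_3$, $\mu_2-2e_1+e_2-2\mu_2e_3$, $-3-\mu_2e_1+\mu_2e_2+6e_3$. * B→B, $\langle1,1,\delta2^s\rangle\to\langle1,1,\delta2^{s+1}\rangle$ ($s\ge0$, $\delta\in\{1,3\}$): $e_1-e_2,\ e_1+e_2,\ e_3$. * B→C, $\langle1,1,2\rangle\to\langle1,6,2\rangle$: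 $2e_1+2e_3,\ e_2,\ 2e_3-e_1$; and $\langle1,1,6\rangle\to\langle1,6,6\rangle$: $6e_3,\ e_2,\ -e_1$. * B→D, $\langle1,1,4\rangle\to\langle1,5,24\rangle$: $e_1-5e_2+4e_3,\ e_1+e_2+4e_3,\ e_3-e_1$; and $\langle1,1,12\rangle\to\langle1,5,8\rangle$: $\mu_1e_1-5\mu_9e_2+12e_3$, $\mu_1\mu_9e_1+e_2+12\mu_9e_3$, $\mu_1e_3-e_1$. * C→C ($s\ge1$), $\langle1,6,2^s\rangle\to\langle1,6,3\cdot2^{s+1}\rangle$: $-6e_2,\ e_1,\ e_3$; and $\langle1,6,3\cdot2^s\rangle\to\langle1,6,2^{s+1}\rangle$: $-6\mu_4e_2,\ \mu_4e_1,\ e_3$. * C→E, $\langle1,6,4\rangle\to\langle1,2,40\rangle$: $2(\mu_7e_1-3\mu_7e_2-10e_3)$, $e_1+2e_2$, $e_1-3e_2+\mu_7e_3$; and $\langle1,6,12\rangle\to\langle1,2,8\rangle$: $6\mu_4(-\mu_5e_2+2e_3)$, $\mu_4e_1$, $e_2+\mu_5e_3$. * C→F, $\langle1,6,8\rangle\to\langle1,14,80\rangle$: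 $2(\mu_8e_1-3\mu_8e_2-60e_3)$, $e_1+2e_2$, $3e_1-9e_2+\mu_8e_3$; and $\langle1,6,24\rangle\to\langle1,14,16\rangle$: $6\mu_4(-\mu_5e_2+4e_3)$, $\mu_4e_1$, $e_2+\mu_5e_3$. * D→D ($s\ge3$), $\langle1,5,2^s\rangle\to\langle1,5,3\cdot2^{s+1}\rangle$: $e_1-5e_2,\ e_1+e_2,\ e_3$; and $\langle1,5,3\cdot2^s\rangle\to\langle1,5,2^{s+1}\rangle$: $e_1-5\mu_9e_2,\ \mu_9e_1+e_2,\ e_3$. * E→E, $\langle1,2,\delta2^s\rangle\to\langle1,2,\delta2^{s+1}\rangle$ ($s\ge3$, $\delta\in\{1,5\}$): $-2e_2,\ e_1,\ e_3$. * E→G, $\langle1,2,8\rangle\to\langle1,10,16\rangle$: $-2e_2+8e_3,\ e_1,\ e_2+e_3$; and $\langle1,2,40\rangle\to\langle1,10,80\rangle$: $-2\mu_6e_2+40e_3,\ e_1,\ e_2+\mu_6e_3$. * F→F, $\langle1,14,\delta2^s\rangle\to\langle1,14,\delta2^{s+1}\rangle$ ($s\ge4$, $\delta\in\{1,5\}$):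 $2e_1-14\mu_{10}e_2,\ \mu_{10}e_1+2e_2,\ e_3$. * G→G ($s\ge4$), $\langle1,10,2^s\rangle\to\langle1,10,5\cdot2^{s+1}\rangle$: $-10e_2,\ e_1,\ e_3$; and $\langle1,10,5\cdot2^s\rangle\to\langle1,10,2^{s+1}\rangle$: $-10\mu_3e_2,\ \mu_3e_1,\ e_3$. **Proposition.** Let $1,e_1,e_2,e_3$ be a quasi-good basis of an order $R$ of $B_2$ for a form $f$, let $g$ be a form beneath $f$ in the list above, and let $R'$ be the suborder $\langle1,d_1,d_2,d_3\rangle_{\mathcal O_2}$ of $R$, with $d_1,d_2,d_3$ as in the list. Let $S\subset\mathcal O_2$ be a set of representatives of $k_2$; below $a$ and $b$ run over $S$, subject to the stated conditions, where congruences are modulo $2\mathcal O_2$. Then $[R^\times:R'^\times]$ and a system of representatives for $R'^\times\backslash R^\times$ (the classes $R'^\times x$) are the following, $s$ and $\delta$ being the parameters of $f$. | $R\to R'$ | $[R^\times:R'^\times]$ | representatives | condition | |---|---|---|---| | A1→A1 | $q+1$ | $e_1+e_2$; $1+ae_2$ | $s=0$ | | A1→A1 | $q$ | $1+ae_2$ |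 $s\ge1$ | | A1→A2 | $q(q-1)$ | $(1+ae_2)(e_1+be_2)$, $b\not\equiv0$ | $r$ odd | | A1→A2 | $q(q+1)$ | $(e_1+be_2)(1+ae_2)$, $b\not\equiv0$; $(b+e_1)(1+ae_2)$, $b^2+b+1\equiv0$ | $r$ even | | A1→B | $q-1$ | $1+ae_3$, $a\not\equiv1$ | | | A2→A2 | $q^2$ | $1+ae_1+be_2$ | | | A2→B | $q-1$ | $e_3$; $1+ae_3$, $a^2+a+1\not\equiv0$ | $r$ even | | A2→B | $q+1$ | $e_3$; $1+ae_3$ | $r$ odd | | B→B | $q$ | $e_2$; $1+ae_2$, $a\not\equiv1$ | $s=0$ | | B→B | $q$ | $1+ae_2$ | $s\ge1$ | | B→C | $q$ | $e_3$; $1+ae_3$, $a\not\equiv1$ | | | B→D | $q$ | $1+ae_2$ | | | C→C, D→D, E→E, F→F, G→G | $q$ | $1$; $a+e_2$, $a\not\equiv0$ | | | C→E, C→F | $q$ | $1$; $a+e_2$, $a\not\equiv0$ | $\delta=1$ | | C→E, C→F | $q$ | $1$; $a+e_3$, $a\not\equiv0$ | $\delta=3$ | | E→G | $q$ | $1$;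 $a+e_3$, $a\not\equiv0$ | | -/

import Mathlib

namespace DyadicBass

/-- The ternary quadratic forms attached to dyadic Bass orders, grouped in classes:
`A1 s = H ⊥ ⟨2^s⟩`, `A2 s = J ⊥ ⟨2^s⟩`, with `H = (0 1; 1 0)`, `J = (2 1; 1 2)`, and
`B δ s = ⟨1, 1, δ 2^s⟩`, `C δ s = ⟨1, 6, δ 2^s⟩`, `D δ s = ⟨1, 5, δ 2^s⟩`,
`E δ s = ⟨1, 2, δ 2^s⟩`, `F δ s = ⟨1, 14, δ 2^s⟩`, `G δ s = ⟨1, 10, δ 2^s⟩`. -/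
inductive BassForm : Type
  | A1 (s : ℕ)
  | A2 (s : ℕ)
  | B (δ s : ℕ)
  | C (δ s : ℕ)
  | D (δ s : ℕ)
  | E (δ s : ℕ)
  | F (δ s : ℕ)
  | G (δ s : ℕ)

section Tables

variable {B : Type*} [Ring B]

/-- The multiplication table of a good basis `1, e₁, e₂, e₃` for the form `⟨1, a, b⟩`. -/
def DiagTable (a b : ℕ) (e₁ e₂ e₃ : B) : Prop :=
  e₁ * e₁ = -((a : B) * b) ∧ e₂ * e₂ = -(b : B) ∧ e₃ * e₃ = -(a : B) ∧
  e₁ * e₂ = -((b : B) * e₃) ∧ e₂ * e₃ = -e₁ ∧ e₃ * e₁ = -((a : B) * e₂) ∧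
  e₂ * e₁ = (b : B) * e₃ ∧ e₃ * e₂ = e₁ ∧ e₁ * e₃ = (a : B) * e₂

/-- The multiplication table of a good basis `1, e₁, e₂, e₃` for the form `H ⊥ ⟨t⟩`. -/
def HypTable (t : ℕ) (e₁ e₂ e₃ : B) : Prop :=
  e₁ * e₁ = 0 ∧ e₂ * e₂ = 0 ∧ e₃ * e₃ = e₃ ∧
  e₁ * e₂ = (t : B) * (1 - e₃) ∧ e₂ * e₃ = 0 ∧ e₃ * e₁ = 0 ∧
  e₂ * e₁ = (t : B) * e₃ ∧ e₃ * e₂ = e₂ ∧ e₁ * e₃ = e₁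

/-- The multiplication table of a good basis `1, e₁, e₂, e₃` for the form `J ⊥ ⟨t⟩`. -/
def JTable (t : ℕ) (e₁ e₂ e₃ : B) : Prop :=
  e₁ * e₁ = -(t : B) ∧ e₂ * e₂ = -(t : B) ∧ e₃ * e₃ = e₃ - 1 ∧
  e₁ * e₂ = (t : B) * (1 - e₃) ∧ e₂ * e₃ = -e₁ ∧ e₃ * e₁ = -e₂ ∧
  e₂ * e₁ = (t : B) * e₃ ∧ e₃ * e₂ = e₁ + e₂ ∧ e₁ * e₃ = e₁ + e₂

/-- The multiplication table of a good basis for each of the forms. -/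
def BassForm.MulTable : BassForm → B → B → B → Prop
  | .A1 s => HypTable (2 ^ s)
  | .A2 s => JTable (2 ^ s)
  | .B δ s => DiagTable 1 (δ * 2 ^ s)
  | .C δ s => DiagTable 6 (δ * 2 ^ s)
  | .D δ s => DiagTable 5 (δ * 2 ^ s)
  | .E δ s => DiagTable 2 (δ * 2 ^ s)
  | .F δ s => DiagTable 14 (δ * 2 ^ s)
  | .G δ s => DiagTable 10 (δ * 2 ^ s)

end Tables

section Orders

variable {R : Type*} [CommRing R] {B : Type*} [Ring B] [Algebra R B]

/-- `1, e₁, e₂, e₃` is a basis of the order `O` as an `R`-module. -/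
def IsOrderBasis (O : Subalgebra R B) (e₁ e₂ e₃ : B) : Prop :=
  LinearIndependent R ![1, e₁, e₂, e₃] ∧
    Submodule.span R {1, e₁, e₂, e₃} = Subalgebra.toSubmodule O

/-- `1, e₁, e₂, e₃` is a good basis of the order `O` with respect to the form `f`
(so that `O` corresponds to `f`). -/
def IsGoodBasis (f : BassForm) (O : Subalgebra R B) (e₁ e₂ e₃ : B) : Prop :=
  IsOrderBasis O e₁ e₂ e₃ ∧ f.MulTable e₁ e₂ e₃

/-- `1, e₁, e₂, e₃` is a quasi-good basis of `O` with respect to `f`: a basis of `O`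
congruent modulo `2 O` to a good basis. -/
def IsQuasiGoodBasis (f : BassForm) (O : Subalgebra R B) (e₁ e₂ e₃ : B) : Prop :=
  IsOrderBasis O e₁ e₂ e₃ ∧
    ∃ g₁ g₂ g₃ : B, IsGoodBasis f O g₁ g₂ g₃ ∧
      (∃ x ∈ O, g₁ - e₁ = 2 * x) ∧ (∃ x ∈ O, g₂ - e₂ = 2 * x) ∧ (∃ x ∈ O, g₃ - e₃ = 2 * x)

/-- The unit group of an order `O` of `B`, as a subgroup of `Bˣ`. -/
def unitGroup (O : Subalgebra R B) : Subgroup Bˣ :=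
  O.toSubsemiring.toSubmonoid.units

end Orders

/-- `T` is a system of representatives of the quotient set `U' \ U` of classes `U' x`, `x ∈ U`. -/
def IsRightCosetReps {B : Type*} [Ring B] (U' U : Subgroup Bˣ) (T : Set B) : Prop :=
  (∀ t ∈ T, ∃ x ∈ U, (x : B) = t) ∧
    ∀ x ∈ U, ∃! t : B, t ∈ T ∧ ∃ u ∈ U', (x : B) = u * t

/-- A choice of the square roots that enter in the construction of the suborders. By Hensel's
lemma they all exist in the ring of `2`-adic integers, hence in its finite extensions. -/
structure SquareRoots (R : Type*) [CommRing R] where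
  μ₁ : R
  μ₂ : R
  μ₃ : R
  μ₄ : R
  μ₅ : R
  μ₆ : R
  μ₇ : R
  μ₈ : R
  μ₉ : R
  μ₁₀ : R
  eq₁ : μ₁ ^ 2 = -7
  eq₂ : 3 * μ₂ ^ 2 = -13
  eq₃ : 25 * μ₃ ^ 2 = 1
  eq₄ : 9 * μ₄ ^ 2 = 1
  eq₅ : 3 * μ₅ ^ 2 = -5
  eq₆ : μ₆ ^ 2 = -15
  eq₇ : 3 * μ₇ ^ 2 = -29
  eq₈ : 3 * μ₈ ^ 2 = -533
  eq₉ : 15 * μ₉ ^ 2 = -1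
  eq₁₀ : 7 * μ₁₀ ^ 2 = -1

/-- `Descent f g` lists the pairs of forms `f`, `g` with `g` beneath `f`. -/
inductive Descent : BassForm → BassForm → Type
  | A1A2 : Descent (.A1 0) (.A2 2)
  | A1A1 (s : ℕ) : Descent (.A1 s) (.A1 (s + 1))
  | A1B : Descent (.A1 1) (.B 3 0)
  | A2A2 (s : ℕ) (hs : 1 ≤ s) : Descent (.A2 s) (.A2 (s + 2))
  | A2B : Descent (.A2 1) (.B 1 0)
  | BB (δ s : ℕ) (hδ : δ = 1 ∨ δ = 3) : Descent (.B δ s) (.B δ (s + 1))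
  | BC₁ : Descent (.B 1 1) (.C 1 1)
  | BC₃ : Descent (.B 3 1) (.C 3 1)
  | BD₁ : Descent (.B 1 2) (.D 3 3)
  | BD₃ : Descent (.B 3 2) (.D 1 3)
  | CC₁ (s : ℕ) (hs : 1 ≤ s) : Descent (.C 1 s) (.C 3 (s + 1))
  | CC₃ (s : ℕ) (hs : 1 ≤ s) : Descent (.C 3 s) (.C 1 (s + 1))
  | CE₁ : Descent (.C 1 2) (.E 5 3)
  | CE₃ : Descent (.C 3 2) (.E 1 3)
  | CF₁ : Descent (.C 1 3) (.F 5 4)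
  | CF₃ : Descent (.C 3 3) (.F 1 4)
  | DD₁ (s : ℕ) (hs : 3 ≤ s) : Descent (.D 1 s) (.D 3 (s + 1))
  | DD₃ (s : ℕ) (hs : 3 ≤ s) : Descent (.D 3 s) (.D 1 (s + 1))
  | EE (δ s : ℕ) (hδ : δ = 1 ∨ δ = 5) (hs : 3 ≤ s) : Descent (.E δ s) (.E δ (s + 1))
  | EG₁ : Descent (.E 1 3) (.G 1 4)
  | EG₅ : Descent (.E 5 3) (.G 5 4)
  | FF (δ s : ℕ) (hδ : δ = 1 ∨ δ = 5) (hs : 4 ≤ s) : Descent (.F δ s) (.F δ (s + 1))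
  | GG₁ (s : ℕ) (hs : 4 ≤ s) : Descent (.G 1 s) (.G 5 (s + 1))
  | GG₅ (s : ℕ) (hs : 4 ≤ s) : Descent (.G 5 s) (.G 1 (s + 1))

namespace Descent

section Suborder

variable {R : Type*} [CommRing R] {B : Type*} [Ring B] [Algebra R B]

/-- The elements `(d₁, d₂, d₃)` that the construction of a suborder attaches to a (quasi-)good
basis `1, e₁, e₂, e₃` of an order corresponding to `f`, for the form `g` beneath `f`. -/
def gens (μ : SquareRoots R) (e₁ e₂ e₃ : B) {f g : BassForm} : Descent f g → B × B × B
  | A1A2 =>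
      (2 * (μ.μ₁ • (1 : B) - 2 * e₁ - 3 * e₂ - (2 * μ.μ₁) • e₃),
        2 * (-(μ.μ₁ • (1 : B)) + 3 * e₁ + 2 * e₂ + (2 * μ.μ₁) • e₃),
        -2 - μ.μ₁ • e₁ - μ.μ₁ • e₂ + 5 * e₃)
  | A1A1 _ => (e₁, 2 * e₂, e₃)
  | A1B =>
      (μ.μ₁ • (1 : B) + e₁ + 2 * e₂ - (2 * μ.μ₁) • e₃,
        -5 + (2 * μ.μ₁) • e₁ + μ.μ₁ • e₂ + 10 * e₃,
        μ.μ₁ • (1 : B) + 3 * e₁ + e₂ - (2 * μ.μ₁) • e₃)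
  | A2A2 _ _ => (2 * e₁, 2 * e₂, e₃)
  | A2B =>
      (μ.μ₂ • (1 : B) - e₁ + 2 * e₂ - (2 * μ.μ₂) • e₃,
        μ.μ₂ • (1 : B) - 2 * e₁ + e₂ - (2 * μ.μ₂) • e₃,
        -3 - μ.μ₂ • e₁ + μ.μ₂ • e₂ + 6 * e₃)
  | BB _ _ _ => (e₁ - e₂, e₁ + e₂, e₃)
  | BC₁ => (2 * e₁ + 2 * e₃, e₂, 2 * e₃ - e₁)
  | BC₃ => (6 * e₃, e₂, -e₁)
  | BD₁ => (e₁ - 5 * e₂ + 4 * e₃, e₁ + e₂ + 4 * e₃, e₃ - e₁)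
  | BD₃ =>
      (μ.μ₁ • e₁ - (5 * μ.μ₉) • e₂ + 12 * e₃,
        (μ.μ₁ * μ.μ₉) • e₁ + e₂ + (12 * μ.μ₉) • e₃,
        μ.μ₁ • e₃ - e₁)
  | CC₁ _ _ => (-(6 * e₂), e₁, e₃)
  | CC₃ _ _ => (-((6 * μ.μ₄) • e₂), μ.μ₄ • e₁, e₃)
  | CE₁ =>
      (2 * (μ.μ₇ • e₁ - (3 * μ.μ₇) • e₂ - 10 * e₃), e₁ + 2 * e₂, e₁ - 3 * e₂ + μ.μ₇ • e₃)
  | CE₃ =>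
      ((6 * μ.μ₄) • (-(μ.μ₅ • e₂) + 2 * e₃), μ.μ₄ • e₁, e₂ + μ.μ₅ • e₃)
  | CF₁ =>
      (2 * (μ.μ₈ • e₁ - (3 * μ.μ₈) • e₂ - 60 * e₃), e₁ + 2 * e₂,
        3 * e₁ - 9 * e₂ + μ.μ₈ • e₃)
  | CF₃ =>
      ((6 * μ.μ₄) • (-(μ.μ₅ • e₂) + 4 * e₃), μ.μ₄ • e₁, e₂ + μ.μ₅ • e₃)
  | DD₁ _ _ => (e₁ - 5 * e₂, e₁ + e₂, e₃)
  | DD₃ _ _ => (e₁ - (5 * μ.μ₉) • e₂, μ.μ₉ • e₁ + e₂, e₃)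
  | EE _ _ _ _ => (-(2 * e₂), e₁, e₃)
  | EG₁ => (-(2 * e₂) + 8 * e₃, e₁, e₂ + e₃)
  | EG₅ => (-((2 * μ.μ₆) • e₂) + 40 * e₃, e₁, e₂ + μ.μ₆ • e₃)
  | FF _ _ _ _ => (2 * e₁ - (14 * μ.μ₁₀) • e₂, μ.μ₁₀ • e₁ + 2 * e₂, e₃)
  | GG₁ _ _ => (-(10 * e₂), e₁, e₃)
  | GG₅ _ _ => (-((10 * μ.μ₃) • e₂), μ.μ₃ • e₁, e₃)

/-- The lattice `⟨1, d₁, d₂, d₃⟩`, which is the underlying lattice of the suborder of `O` that the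
construction produces from the quasi-good basis `1, e₁, e₂, e₃` of `O`. -/
def lattice (μ : SquareRoots R) (e₁ e₂ e₃ : B) {f g : BassForm} (D : Descent f g) :
    Submodule R B :=
  Submodule.span R {1, (D.gens μ e₁ e₂ e₃).1, (D.gens μ e₁ e₂ e₃).2.1, (D.gens μ e₁ e₂ e₃).2.2}

end Suborder

/-- The index of the unit groups, where `q = 2 ^ r` is the order of the residue field. -/
def unitIndex (q r : ℕ) {f g : BassForm} : Descent f g → ℕ
  | A1A1 s => if s = 0 then q + 1 else q
  | A1A2 => if Even r then q * (q + 1) else q * (q - 1)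
  | A1B => q - 1
  | A2A2 _ _ => q ^ 2
  | A2B => if Even r then q - 1 else q + 1
  | BB _ _ _ => q
  | BC₁ => q
  | BC₃ => q
  | BD₁ => q
  | BD₃ => q
  | CC₁ _ _ => q
  | CC₃ _ _ => q
  | CE₁ => q
  | CE₃ => q
  | CF₁ => q
  | CF₃ => q
  | DD₁ _ _ => q
  | DD₃ _ _ => q
  | EE _ _ _ _ => q
  | EG₁ => q
  | EG₅ => q
  | FF _ _ _ _ => q
  | GG₁ _ _ => q
  | GG₅ _ _ => q

section Representatives

variable {R : Type*} [CommRing R] [IsLocalRing R] {B : Type*} [Ring B] [Algebra R B]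

open IsLocalRing (residue)

/-- The elements `1` and `a + e`, for `a ∈ S` nonzero in the residue field. -/
def shiftReps (S : Set R) (e : B) : Set B :=
  {1} ∪ {x | ∃ a ∈ S, residue R a ≠ 0 ∧ x = a • (1 : B) + e}

open Classical in
/-- The representatives for the classes of units, where `S` is a set of representatives in `R` of
the residue field, and the residue field has `2 ^ r` elements. -/
noncomputable def unitReps (S : Set R) (r : ℕ) (e₁ e₂ e₃ : B) {f g : BassForm} :
    Descent f g → Set B
  | A1A1 s =>
      if s = 0 then {e₁ + e₂} ∪ {x | ∃ a ∈ S, x = 1 + a • e₂}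
      else {x | ∃ a ∈ S, x = 1 + a • e₂}
  | A1A2 =>
      if Even r then
        {x | ∃ a ∈ S, ∃ b ∈ S, residue R b ≠ 0 ∧ x = (e₁ + b • e₂) * (1 + a • e₂)} ∪
        {x | ∃ a ∈ S, ∃ b ∈ S, residue R b ^ 2 + residue R b + 1 = 0 ∧
          x = (b • (1 : B) + e₁) * (1 + a • e₂)}
      else
        {x | ∃ a ∈ S, ∃ b ∈ S, residue R b ≠ 0 ∧ x = (1 + a • e₂) * (e₁ + b • e₂)}
  | A1B => {x | ∃ a ∈ S, residue R a ≠ 1 ∧ x = 1 + a • e₃}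
  | A2A2 _ _ => {x | ∃ a ∈ S, ∃ b ∈ S, x = 1 + a • e₁ + b • e₂}
  | A2B =>
      if Even r then
        {e₃} ∪ {x | ∃ a ∈ S, residue R a ^ 2 + residue R a + 1 ≠ 0 ∧ x = 1 + a • e₃}
      else {e₃} ∪ {x | ∃ a ∈ S, x = 1 + a • e₃}
  | BB _ s _ =>
      if s = 0 then {e₂} ∪ {x | ∃ a ∈ S, residue R a ≠ 1 ∧ x = 1 + a • e₂}
      else {x | ∃ a ∈ S, x = 1 + a • e₂}
  | BC₁ => {e₃} ∪ {x | ∃ a ∈ S, residue R a ≠ 1 ∧ x = 1 + a • e₃}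
  | BC₃ => {e₃} ∪ {x | ∃ a ∈ S, residue R a ≠ 1 ∧ x = 1 + a • e₃}
  | BD₁ => {x | ∃ a ∈ S, x = 1 + a • e₂}
  | BD₃ => {x | ∃ a ∈ S, x = 1 + a • e₂}
  | CC₁ _ _ => shiftReps S e₂
  | CC₃ _ _ => shiftReps S e₂
  | CE₁ => shiftReps S e₂
  | CE₃ => shiftReps S e₃
  | CF₁ => shiftReps S e₂
  | CF₃ => shiftReps S e₃
  | DD₁ _ _ => shiftReps S e₂
  | DD₃ _ _ => shiftReps S e₂
  | EE _ _ _ _ => shiftReps S e₂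
  | EG₁ => shiftReps S e₃
  | EG₅ => shiftReps S e₃
  | FF _ _ _ _ => shiftReps S e₂
  | GG₁ _ _ => shiftReps S e₂
  | GG₅ _ _ => shiftReps S e₂

end Representatives

end Descent

end DyadicBass

/-! Everything happens modulo 2. Multiplication in a quasi-good basis agrees modulo `2O` with the
even Clifford algebra of the form `f`, so `O/2O` is the even Clifford algebra of the reduced form
over the residue field `k`. Only six reduced forms occur. Each listed suborder `O'` contains `2O`:
the determinant of `d₁, d₂, d₃` in the coordinates `e₁, e₂, e₃` is 2 times a unit, or two generators
are divisible by 2 and the determinant is a unit after dividing them. Hence `O'` is the full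
preimage of a subspace `L` of `O/2O` containing 1 (`IsOrderBasis.mem_suborder_iff`).

By Nakayama, an element of `O` is a unit exactly when its reduced norm is nonzero modulo 2, and then
its inverse reduces to the conjugate divided by the norm. The conjugate is the trace minus the
element, so it stays in `L`. Therefore the units of `O'` are the units of `O` lying in `O'`, and `x
y⁻¹` is a unit of `O'` if and only if the reduction of `x` times the conjugate of that of `y` lies
in `L` (`mul_inv_mem_unitGroup_iff`). The statement becomes: for every `x` of nonzero norm over `k`,
exactly one listed `y` satisfies this condition (`relIndex_and_isRightCosetReps`).

For a one-parameter family of representatives and a hyperplane `L`, the condition reads `β = a α`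
with `α`, `β` linear in `x`. It has the unique solution `β / α`, an exceptional representative
taking care of `α = 0`; the norm excludes the forbidden values of `a`. When `L` is a plane there are
two linear equations in two parameters, solved by Cramer's rule. The parity of `r` enters through
the roots of `b² + b + 1`, which lie in `k` exactly when 3 divides `2 ^ r - 1`. -/

namespace DyadicBass

/-- The coefficients of a ternary quadratic form `a x² + b y² + c z² + w x y`. -/
structure TernaryCoeffs (R : Type*) where
  a : R
  b : R
  c : R
  w : R

/-! ### Even Clifford algebras of ternary forms, in coordinates. -/

namespace TernaryCoeffs

/-- The image of a ternary form under a map of the coefficients. -/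
def map {R k : Type*} (φ : R → k) (Q : TernaryCoeffs R) : TernaryCoeffs k :=
  ⟨φ Q.a, φ Q.b, φ Q.c, φ Q.w⟩

section

variable {R : Type*} [CommRing R] (Q : TernaryCoeffs R)

/-- The product of the even Clifford algebra, in coordinates for the basis `1, e₁, e₂, e₃`. -/
def mul (x y : Fin 4 → R) : Fin 4 → R :=
  ![x 0 * y 0 - Q.b * Q.c * x 1 * y 1 - Q.a * Q.c * x 2 * y 2 - Q.a * Q.b * x 3 * y 3 +
      Q.c * Q.w * x 1 * y 2,
    x 0 * y 1 + x 1 * y 0 - Q.a * x 2 * y 3 + Q.a * x 3 * y 2 + Q.w * x 1 * y 3,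
    x 0 * y 2 + x 2 * y 0 + Q.w * x 3 * y 2 - Q.b * x 3 * y 1 + Q.b * x 1 * y 3,
    x 0 * y 3 + x 3 * y 0 + Q.w * x 3 * y 3 - Q.c * x 1 * y 2 + Q.c * x 2 * y 1]

/-- The canonical involution of the even Clifford algebra. -/
def conj (x : Fin 4 → R) : Fin 4 → R := ![x 0 + Q.w * x 3, -x 1, -x 2, -x 3]

/-- The reduced norm of the even Clifford algebra. -/
def norm (x : Fin 4 → R) : R :=
  x 0 ^ 2 + Q.b * Q.c * x 1 ^ 2 + Q.a * Q.c * x 2 ^ 2 + Q.a * Q.b * x 3 ^ 2 +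
    Q.w * x 0 * x 3 - Q.c * Q.w * x 1 * x 2

/-- The unit element of the even Clifford algebra. -/
def one : Fin 4 → R := ![1, 0, 0, 0]

theorem norm_mul (x y : Fin 4 → R) : Q.norm (Q.mul x y) = Q.norm x * Q.norm y := by
  simp only [norm, mul, Matrix.cons_val]; ring

theorem norm_one : Q.norm one = 1 := by
  simp [norm, one]

theorem mul_conj_self (x : Fin 4 → R) : Q.mul x (Q.conj x) = Q.norm x • one := by
  ext i; fin_cases i <;> simp [norm, mul, conj, one] <;> ring

theorem conj_mul_self (x : Fin 4 → R) : Q.mul (Q.conj x) x = Q.norm x • one := by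
  ext i; fin_cases i <;> simp [norm, mul, conj, one] <;> ring

theorem conj_mul_mul (x y : Fin 4 → R) : Q.mul (Q.conj x) (Q.mul x y) = Q.norm x • y := by
  ext i; fin_cases i <;> simp [norm, mul, conj] <;> ring

theorem mul_mul_conj (x y : Fin 4 → R) : Q.mul (Q.mul x y) (Q.conj y) = Q.norm y • x := by
  ext i; fin_cases i <;> simp [norm, mul, conj] <;> ring

theorem mul_smul (r : R) (x y : Fin 4 → R) : Q.mul x (r • y) = r • Q.mul x y := by
  ext i; fin_cases i <;> simp [mul] <;> ring

theorem smul_mul (r : R) (x y : Fin 4 → R) : Q.mul (r • x) y = r • Q.mul x y := by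
  ext i; fin_cases i <;> simp [mul] <;> ring

/-- The scalar is the reduced trace. Consequently conjugation preserves every submodule containing
1, whether or not it is closed under products. -/
theorem conj_eq (x : Fin 4 → R) : Q.conj x = (2 * x 0 + Q.w * x 3) • one - x := by
  ext i; fin_cases i <;> simp [conj, one]; ring

theorem conj_mem {L : Submodule R (Fin 4 → R)} (h1 : one ∈ L) {x : Fin 4 → R} (hx : x ∈ L) :
    Q.conj x ∈ L := by
  rw [conj_eq]
  exact L.sub_mem (L.smul_mem _ h1) hx

theorem map_mul {k : Type*} [CommRing k] (φ : R →+* k) (x y : Fin 4 → R) :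
    φ ∘ Q.mul x y = (Q.map φ).mul (φ ∘ x) (φ ∘ y) := by
  ext i; fin_cases i <;> simp [mul, map]

end

section Table

variable {R : Type*} [CommRing R] {B : Type*} [Ring B] [Algebra R B]

/-- The multiplication table of the even Clifford algebra of a ternary form. -/
def Table (Q : TernaryCoeffs R) (e₁ e₂ e₃ : B) : Prop :=
  e₁ * e₁ = -(Q.b * Q.c) • (1 : B) ∧ e₂ * e₂ = -(Q.a * Q.c) • (1 : B) ∧
  e₃ * e₃ = Q.w • e₃ - (Q.a * Q.b) • (1 : B) ∧
  e₁ * e₂ = (Q.c * Q.w) • (1 : B) - Q.c • e₃ ∧ e₂ * e₃ = -Q.a • e₁ ∧ e₃ * e₁ = -Q.b • e₂ ∧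
  e₂ * e₁ = Q.c • e₃ ∧ e₃ * e₂ = Q.a • e₁ + Q.w • e₂ ∧ e₁ * e₃ = Q.b • e₂ + Q.w • e₁

/-- The ternary form over `R` that a `BassForm` stands for. -/
def ofBassForm (R : Type*) [CommRing R] : BassForm → TernaryCoeffs R
  | .A1 s => ⟨0, 0, 2 ^ s, 1⟩
  | .A2 s => ⟨1, 1, 2 ^ s, 1⟩
  | .B δ s => ⟨1, 1, δ * 2 ^ s, 0⟩
  | .C δ s => ⟨1, 6, δ * 2 ^ s, 0⟩
  | .D δ s => ⟨1, 5, δ * 2 ^ s, 0⟩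
  | .E δ s => ⟨1, 2, δ * 2 ^ s, 0⟩
  | .F δ s => ⟨1, 14, δ * 2 ^ s, 0⟩
  | .G δ s => ⟨1, 10, δ * 2 ^ s, 0⟩

theorem natCast_eq_smul_one (n : ℕ) : (n : B) = (n : R) • (1 : B) := by
  rw [Nat.cast_smul_eq_nsmul, nsmul_one]

/-- The Gram matrices `H` and `J` stand for `xy` and `x² + xy + y²`. This is why `w = 1` here and in
the next lemma, while the diagonal forms have `w = 0`. -/
theorem table_of_hypTable {t : ℕ} {e₁ e₂ e₃ : B} (h : HypTable t e₁ e₂ e₃) :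
    Table (⟨0, 0, t, 1⟩ : TernaryCoeffs R) e₁ e₂ e₃ := by
  obtain ⟨h1, h2, h3, h4, h5, h6, h7, h8, h9⟩ := h
  refine ⟨?_, ?_, ?_, ?_, ?_, ?_, ?_, ?_, ?_⟩ <;>
    simp only [h1, h2, h3, h4, h5, h6, h7, h8, h9, natCast_eq_smul_one (R := R) (B := B),
      smul_mul_assoc, one_mul] <;> module

theorem table_of_jTable {t : ℕ} {e₁ e₂ e₃ : B} (h : JTable t e₁ e₂ e₃) :
    Table (⟨1, 1, t, 1⟩ : TernaryCoeffs R) e₁ e₂ e₃ := by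
  obtain ⟨h1, h2, h3, h4, h5, h6, h7, h8, h9⟩ := h
  refine ⟨?_, ?_, ?_, ?_, ?_, ?_, ?_, ?_, ?_⟩ <;>
    simp only [h1, h2, h3, h4, h5, h6, h7, h8, h9, natCast_eq_smul_one (R := R) (B := B),
      smul_mul_assoc, one_mul] <;> module

theorem table_of_diagTable {a b : ℕ} {e₁ e₂ e₃ : B} (h : DiagTable a b e₁ e₂ e₃) :
    Table (⟨1, a, b, 0⟩ : TernaryCoeffs R) e₁ e₂ e₃ := by
  obtain ⟨h1, h2, h3, h4, h5, h6, h7, h8, h9⟩ := h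
  refine ⟨?_, ?_, ?_, ?_, ?_, ?_, ?_, ?_, ?_⟩ <;>
    simp only [h1, h2, h3, h4, h5, h6, h7, h8, h9, natCast_eq_smul_one (R := R) (B := B),
      smul_mul_assoc, one_mul] <;> module

theorem table_of_mulTable {f : BassForm} {e₁ e₂ e₃ : B} (h : f.MulTable e₁ e₂ e₃) :
    Table (ofBassForm R f) e₁ e₂ e₃ := by
  cases f
  case A1 s => simpa [ofBassForm] using table_of_hypTable (R := R) h
  case A2 s => simpa [ofBassForm] using table_of_jTable (R := R) h
  all_goals simpa [ofBassForm] using table_of_diagTable (R := R) h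

end Table

end TernaryCoeffs

/-! ### Orders in coordinates, and quasi-good bases. -/

section Coordinates

variable {R : Type*} [CommRing R] {B : Type*} [Ring B] [Algebra R B]

/-- The element of `B` with given coordinates with respect to `1, e₁, e₂, e₃`. -/
def ofCoords (R : Type*) [CommRing R] [Algebra R B] (e₁ e₂ e₃ : B) : (Fin 4 → R) →ₗ[R] B :=
  Fintype.linearCombination R ![1, e₁, e₂, e₃]

theorem ofCoords_apply (e₁ e₂ e₃ : B) (x : Fin 4 → R) :
    ofCoords R e₁ e₂ e₃ x = x 0 • (1 : B) + x 1 • e₁ + x 2 • e₂ + x 3 • e₃ := by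
  simp [ofCoords, Fintype.linearCombination_apply, Fin.sum_univ_four]

theorem ofCoords_one (e₁ e₂ e₃ : B) : ofCoords R e₁ e₂ e₃ TernaryCoeffs.one = 1 := by
  simp [ofCoords_apply, TernaryCoeffs.one]

theorem range_ofCoords (e₁ e₂ e₃ : B) :
    LinearMap.range (ofCoords R e₁ e₂ e₃) = Submodule.span R {1, e₁, e₂, e₃} := by
  rw [ofCoords, Fintype.range_linearCombination]
  congr 1
  ext x
  simp [eq_comm]
  tauto

theorem TernaryCoeffs.Table.ofCoords_mul {Q : TernaryCoeffs R} {e₁ e₂ e₃ : B}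
    (h : Q.Table e₁ e₂ e₃) (x y : Fin 4 → R) :
    ofCoords R e₁ e₂ e₃ x * ofCoords R e₁ e₂ e₃ y = ofCoords R e₁ e₂ e₃ (Q.mul x y) := by
  obtain ⟨h1, h2, h3, h4, h5, h6, h7, h8, h9⟩ := h
  simp only [ofCoords_apply, mul_add, add_mul, smul_mul_assoc, mul_smul_comm, one_mul, mul_one,
    h1, h2, h3, h4, h5, h6, h7, h8, h9, TernaryCoeffs.mul, Matrix.cons_val]
  module

namespace IsOrderBasis

variable {O : Subalgebra R B} {e₁ e₂ e₃ : B}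

theorem injective (h : IsOrderBasis O e₁ e₂ e₃) : Function.Injective (ofCoords R e₁ e₂ e₃) :=
  h.1.fintypeLinearCombination_injective

theorem mem_iff (h : IsOrderBasis O e₁ e₂ e₃) {x : B} :
    x ∈ O ↔ ∃ p, ofCoords R e₁ e₂ e₃ p = x := by
  rw [← LinearMap.mem_range, range_ofCoords, h.2, Subalgebra.mem_toSubmodule]

theorem ofCoords_mem (h : IsOrderBasis O e₁ e₂ e₃) (p : Fin 4 → R) : ofCoords R e₁ e₂ e₃ p ∈ O :=
  h.mem_iff.mpr ⟨p, rfl⟩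

end IsOrderBasis

/-- The good and the quasi-good basis give elements with the same coordinates that differ by an
element of `2O`. As `2O` is a two-sided ideal of `O`, products also change only by an element of
`2O`. -/
theorem IsQuasiGoodBasis.exists_mul_eq {f : BassForm} {O : Subalgebra R B} {e₁ e₂ e₃ : B}
    (h : IsQuasiGoodBasis f O e₁ e₂ e₃) (x y : Fin 4 → R) :
    ∃ z, ofCoords R e₁ e₂ e₃ x * ofCoords R e₁ e₂ e₃ y =
      ofCoords R e₁ e₂ e₃ ((TernaryCoeffs.ofBassForm R f).mul x y + (2 : R) • z) := by
  obtain ⟨hb, g₁, g₂, g₃, ⟨hg, ht⟩, ⟨z₁, hz₁, h₁⟩, ⟨z₂, hz₂, h₂⟩, ⟨z₃, hz₃, h₃⟩⟩ := h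
  have key : ∀ p : Fin 4 → R, ∃ z ∈ O,
      ofCoords R g₁ g₂ g₃ p = ofCoords R e₁ e₂ e₃ p + 2 * z := by
    intro p
    refine ⟨p 1 • z₁ + p 2 • z₂ + p 3 • z₃,
      add_mem (add_mem (O.smul_mem hz₁ _) (O.smul_mem hz₂ _)) (O.smul_mem hz₃ _), ?_⟩
    rw [sub_eq_iff_eq_add] at h₁ h₂ h₃
    simp only [ofCoords_apply, h₁, h₂, h₃, mul_add, mul_smul_comm, smul_add]
    abel
  obtain ⟨zx, hzx, hx⟩ := key x
  obtain ⟨zy, hzy, hy⟩ := key y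
  obtain ⟨zm, hzm, hm⟩ := key ((TernaryCoeffs.ofBassForm R f).mul x y)
  have hmul := (TernaryCoeffs.table_of_mulTable (R := R) ht).ofCoords_mul x y
  have hex := hb.ofCoords_mem x
  have hgy := hg.ofCoords_mem y
  obtain ⟨z, hz⟩ := hb.mem_iff.mp
    (sub_mem hzm (add_mem (mul_mem hex hzy) (mul_mem hzx hgy)))
  refine ⟨z, ?_⟩
  rw [map_add, map_smul, hz, ofNat_smul_eq_nsmul, nsmul_eq_mul, Nat.cast_ofNat]
  rw [hm] at hmul
  have hm' : ofCoords R e₁ e₂ e₃ ((TernaryCoeffs.ofBassForm R f).mul x y) =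
      (ofCoords R e₁ e₂ e₃ x + 2 * zx) * ofCoords R g₁ g₂ g₃ y - 2 * zm := by
    rw [← hx, hmul, add_sub_cancel_right]
  have hy' : ofCoords R e₁ e₂ e₃ y = ofCoords R g₁ g₂ g₃ y - 2 * zy := by
    rw [hy, add_sub_cancel_right]
  rw [hm', hy']
  noncomm_ring

theorem mem_unitGroup {O : Subalgebra R B} {x : Bˣ} : x ∈ unitGroup O ↔ (x : B) ∈ O ∧ ((x⁻¹ : Bˣ) : B) ∈ O :=
  Submonoid.mem_units_iff _ _

end Coordinates

open IsLocalRing (residue ResidueField maximalIdeal)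

/-! ### Units of an order and their reduction modulo 2. -/

section Local

variable {R : Type*} [CommRing R] [IsLocalRing R]

/-- Reduction of coordinates modulo the maximal ideal. -/
noncomputable def red (x : Fin 4 → R) : Fin 4 → ResidueField R := residue R ∘ x

theorem red_add (x y : Fin 4 → R) : red (x + y) = red x + red y := by
  ext i; simp [red]

theorem red_smul (r : R) (x : Fin 4 → R) : red (r • x) = residue R r • red x := by
  ext i; simp [red]

theorem red_one : red (TernaryCoeffs.one : Fin 4 → R) = TernaryCoeffs.one := by
  ext i; fin_cases i <;> simp [red, TernaryCoeffs.one]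

theorem red_surjective (x : Fin 4 → ResidueField R) : ∃ p : Fin 4 → R, red p = x := by
  choose p hp using fun i => IsLocalRing.residue_surjective (x i)
  exact ⟨p, funext hp⟩

theorem residue_two (hR : maximalIdeal R = Ideal.span {2}) : residue R 2 = 0 := by
  rw [IsLocalRing.residue_eq_zero_iff, hR]
  exact Ideal.mem_span_singleton_self 2

theorem red_two_smul (hR : maximalIdeal R = Ideal.span {2}) (z : Fin 4 → R) :
    red ((2 : R) • z) = 0 := by
  rw [red_smul, residue_two hR, zero_smul]

theorem exists_eq_add_of_red_eq (hR : maximalIdeal R = Ideal.span {2}) {p q : Fin 4 → R}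
    (h : red p = red q) : ∃ z : Fin 4 → R, p = q + (2 : R) • z := by
  have : ∀ i, ∃ z, p i = q i + 2 * z := by
    intro i
    have hi : p i - q i ∈ maximalIdeal R := by
      rw [← IsLocalRing.residue_eq_zero_iff, map_sub, sub_eq_zero]
      exact congrFun h i
    rw [hR, Ideal.mem_span_singleton] at hi
    obtain ⟨z, hz⟩ := hi
    exact ⟨z, by rw [← hz]; ring⟩
  choose z hz using this
  exact ⟨z, funext fun i => by simpa using hz i⟩

variable {B : Type*} [Ring B] [Algebra R B] {O : Subalgebra R B} {e₁ e₂ e₃ : B}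

/-- Nakayama's lemma: `O` is contained in `(1 + 2z)O + 2O`, and 2 lies in the Jacobson radical of
`R`, so left multiplication by `1 + 2z` maps `O` onto `O`. -/
theorem exists_mul_one_add_two_mul_eq_one (hR : maximalIdeal R = Ideal.span {2})
    (hO : (Subalgebra.toSubmodule O).FG) {z : B} (hz : z ∈ O) :
    ∃ y ∈ O, (1 + 2 * z) * y = 1 := by
  have hle : Subalgebra.toSubmodule O ≤
      (Subalgebra.toSubmodule O).map (LinearMap.mulLeft R (1 + 2 * z)) := by
    refine Submodule.le_of_le_smul_of_le_jacobson_bot hO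
      (IsLocalRing.maximalIdeal_le_jacobson (⊥ : Ideal R)) fun x hx => ?_
    have : x = (1 + 2 * z) * x + (2 : R) • (-(z * x)) := by
      rw [ofNat_smul_eq_nsmul]
      noncomm_ring
    rw [this]
    refine Submodule.add_mem_sup (Submodule.mem_map_of_mem hx) (Submodule.smul_mem_smul ?_ ?_)
    · rw [hR]; exact Ideal.mem_span_singleton_self 2
    · exact O.neg_mem (O.mul_mem hz hx)
  obtain ⟨y, hy, h⟩ := hle (one_mem O)
  exact ⟨y, hy, h⟩

theorem exists_inverse_one_add_two_mul (hR : maximalIdeal R = Ideal.span {2})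
    (hO : (Subalgebra.toSubmodule O).FG) {z : B} (hz : z ∈ O) :
    ∃ y ∈ O, (1 + 2 * z) * y = 1 ∧ y * (1 + 2 * z) = 1 := by
  obtain ⟨y, hy, h⟩ := exists_mul_one_add_two_mul_eq_one hR hO hz
  obtain ⟨u, -, hu⟩ := exists_mul_one_add_two_mul_eq_one hR hO (neg_mem (mul_mem hz hy))
  -- The right inverse `y` is again of the form `1 + 2z'`, so it has a right inverse too; this
  -- forces `y` to be a two-sided inverse.
  have hy' : 1 + 2 * (-(z * y)) = y := by
    rw [← h]; noncomm_ring
  rw [hy'] at hu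
  exact ⟨y, hy, h, left_inv_eq_right_inv h hu ▸ hu⟩

theorem exists_inverse_of_mul_eq (hR : maximalIdeal R = Ideal.span {2})
    (hO : (Subalgebra.toSubmodule O).FG) {x y y' z z' : B} (hy : y ∈ O) (hz : z ∈ O)
    (hz' : z' ∈ O) (h : x * y = 1 + 2 * z) (h' : y' * x = 1 + 2 * z') :
    ∃ w ∈ O, x * w = 1 ∧ w * x = 1 := by
  obtain ⟨u, hu, h1, -⟩ := exists_inverse_one_add_two_mul hR hO hz
  obtain ⟨u', -, -, h2⟩ := exists_inverse_one_add_two_mul hR hO hz'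
  have hr : x * (y * u) = 1 := by rw [← mul_assoc, h, h1]
  have hl : u' * y' * x = 1 := by rw [mul_assoc, h', h2]
  exact ⟨y * u, mul_mem hy hu, hr, left_inv_eq_right_inv hl hr ▸ hl⟩

/-- The elements `1, e₁, e₂, e₃` form a basis of `O` that multiplies modulo `2` as in the even
Clifford algebra of `Q`. -/
structure IsCliffordBasis (Q : TernaryCoeffs R) (O : Subalgebra R B) (e₁ e₂ e₃ : B) : Prop where
  isOrderBasis : IsOrderBasis O e₁ e₂ e₃
  exists_mul_eq : ∀ x y : Fin 4 → R, ∃ m, ofCoords R e₁ e₂ e₃ x * ofCoords R e₁ e₂ e₃ y =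
    ofCoords R e₁ e₂ e₃ m ∧ red m = (Q.map (residue R)).mul (red x) (red y)

theorem IsQuasiGoodBasis.isCliffordBasis (hR : maximalIdeal R = Ideal.span {2}) {f : BassForm}
    (h : IsQuasiGoodBasis f O e₁ e₂ e₃) :
    IsCliffordBasis (TernaryCoeffs.ofBassForm R f) O e₁ e₂ e₃ where
  isOrderBasis := h.1
  exists_mul_eq x y := by
    obtain ⟨z, hz⟩ := h.exists_mul_eq x y
    refine ⟨_, hz, ?_⟩
    rw [red_add, red_two_smul hR, add_zero]
    exact TernaryCoeffs.map_mul _ _ _ _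

namespace IsCliffordBasis

variable {Q : TernaryCoeffs R}

theorem fg (h : IsCliffordBasis Q O e₁ e₂ e₃) : (Subalgebra.toSubmodule O).FG := by
  rw [← h.isOrderBasis.2]
  exact Submodule.fg_span (Set.toFinite _)

theorem ofCoords_eq_of_red_eq_one (hR : maximalIdeal R = Ideal.span {2}) {m : Fin 4 → R}
    (hm : red m = TernaryCoeffs.one) :
    ∃ z, ofCoords R e₁ e₂ e₃ m = 1 + 2 * ofCoords R e₁ e₂ e₃ z := by
  rw [← red_one] at hm
  obtain ⟨z, rfl⟩ := exists_eq_add_of_red_eq hR hm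
  refine ⟨z, ?_⟩
  rw [map_add, map_smul, ofCoords_one, ofNat_smul_eq_nsmul, nsmul_eq_mul, Nat.cast_ofNat]

theorem red_mul_eq_one (h : IsCliffordBasis Q O e₁ e₂ e₃) {p q : Fin 4 → R}
    (hpq : ofCoords R e₁ e₂ e₃ p * ofCoords R e₁ e₂ e₃ q = 1) :
    (Q.map (residue R)).mul (red p) (red q) = TernaryCoeffs.one := by
  obtain ⟨m, hm, hr⟩ := h.exists_mul_eq p q
  rw [hpq, ← ofCoords_one (R := R) e₁ e₂ e₃] at hm
  rw [← hr, ← h.isOrderBasis.injective hm, red_one]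

theorem norm_ne_zero (h : IsCliffordBasis Q O e₁ e₂ e₃) {p q : Fin 4 → R}
    (hpq : ofCoords R e₁ e₂ e₃ p * ofCoords R e₁ e₂ e₃ q = 1) :
    (Q.map (residue R)).norm (red p) ≠ 0 := by
  intro h0
  have h1 := congrArg (Q.map (residue R)).norm (h.red_mul_eq_one hpq)
  rw [TernaryCoeffs.norm_mul, h0, zero_mul, TernaryCoeffs.norm_one] at h1
  exact zero_ne_one h1

/-- Multiply `p q = 1` on the left by the conjugate of `p`, modulo 2. -/
theorem red_inverse (h : IsCliffordBasis Q O e₁ e₂ e₃) {p q : Fin 4 → R}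
    (hpq : ofCoords R e₁ e₂ e₃ p * ofCoords R e₁ e₂ e₃ q = 1) :
    red q = ((Q.map (residue R)).norm (red p))⁻¹ • (Q.map (residue R)).conj (red p) := by
  have h1 := (Q.map (residue R)).conj_mul_mul (red p) (red q)
  have h2 := (Q.map (residue R)).mul_mul_conj TernaryCoeffs.one (red p)
  rw [h.red_mul_eq_one hpq] at h1
  have h3 : (Q.map (residue R)).mul ((Q.map (residue R)).conj (red p)) TernaryCoeffs.one =
      (Q.map (residue R)).conj (red p) := by
    ext i; fin_cases i <;> simp [TernaryCoeffs.mul, TernaryCoeffs.one]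
  rw [h3] at h1
  rw [h1, smul_smul, inv_mul_cancel₀ (h.norm_ne_zero hpq), one_smul]

/-- Any lift of the conjugate divided by the norm is an inverse modulo 2 on both sides, and elements
of `1 + 2O` are invertible in `O`. -/
theorem exists_unit (hR : maximalIdeal R = Ideal.span {2}) (h : IsCliffordBasis Q O e₁ e₂ e₃)
    {p : Fin 4 → R} (hp : (Q.map (residue R)).norm (red p) ≠ 0) :
    ∃ x ∈ unitGroup O, (x : B) = ofCoords R e₁ e₂ e₃ p := by
  obtain ⟨q, hq⟩ := red_surjective
    (((Q.map (residue R)).norm (red p))⁻¹ • (Q.map (residue R)).conj (red p))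
  obtain ⟨m, hm, hr⟩ := h.exists_mul_eq p q
  obtain ⟨m', hm', hr'⟩ := h.exists_mul_eq q p
  rw [hq, TernaryCoeffs.mul_smul, TernaryCoeffs.mul_conj_self, smul_smul, inv_mul_cancel₀ hp,
    one_smul] at hr
  rw [hq, TernaryCoeffs.smul_mul, TernaryCoeffs.conj_mul_self, smul_smul, inv_mul_cancel₀ hp,
    one_smul] at hr'
  obtain ⟨z, hz⟩ := ofCoords_eq_of_red_eq_one (e₁ := e₁) (e₂ := e₂) (e₃ := e₃) hR hr
  obtain ⟨z', hz'⟩ := ofCoords_eq_of_red_eq_one (e₁ := e₁) (e₂ := e₂) (e₃ := e₃) hR hr'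
  rw [hz] at hm
  rw [hz'] at hm'
  have hE := h.isOrderBasis.ofCoords_mem
  obtain ⟨w, hw, h1, h2⟩ := exists_inverse_of_mul_eq hR h.fg (hE q) (hE z) (hE z') hm hm'
  exact ⟨⟨_, w, h1, h2⟩, mem_unitGroup.mpr ⟨hE p, hw⟩, rfl⟩

variable {O' : Subalgebra R B} {L : Submodule (ResidueField R) (Fin 4 → ResidueField R)}

/-- The inverse reduces to a scalar multiple of the conjugate, which remains in `L` because `L`
contains 1. -/
theorem mem_unitGroup_suborder (h : IsCliffordBasis Q O e₁ e₂ e₃) (h1 : TernaryCoeffs.one ∈ L)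
    (hO' : ∀ p, ofCoords R e₁ e₂ e₃ p ∈ O' ↔ red p ∈ L) {x : Bˣ} (hx : x ∈ unitGroup O) :
    x ∈ unitGroup O' ↔ (x : B) ∈ O' := by
  rw [mem_unitGroup]
  refine ⟨fun h => h.1, fun hx' => ⟨hx', ?_⟩⟩
  obtain ⟨p, hp⟩ := h.isOrderBasis.mem_iff.mp (mem_unitGroup.mp hx).1
  obtain ⟨q, hq⟩ := h.isOrderBasis.mem_iff.mp (mem_unitGroup.mp hx).2
  rw [← hp, hO'] at hx'
  rw [← hq, hO', h.red_inverse (p := p) (q := q) (by rw [hp, hq, Units.mul_inv])]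
  exact L.smul_mem _ (TernaryCoeffs.conj_mem _ h1 hx')

theorem mul_inv_mem_unitGroup_iff (h : IsCliffordBasis Q O e₁ e₂ e₃) (h1 : TernaryCoeffs.one ∈ L)
    (hO' : ∀ p, ofCoords R e₁ e₂ e₃ p ∈ O' ↔ red p ∈ L) {x y : Bˣ} (hx : x ∈ unitGroup O)
    (hy : y ∈ unitGroup O) {p q : Fin 4 → R} (hp : ofCoords R e₁ e₂ e₃ p = x)
    (hq : ofCoords R e₁ e₂ e₃ q = y) :
    x * y⁻¹ ∈ unitGroup O' ↔
      (Q.map (residue R)).mul (red p) ((Q.map (residue R)).conj (red q)) ∈ L := by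
  rw [h.mem_unitGroup_suborder h1 hO' (mul_mem hx (inv_mem hy))]
  obtain ⟨q', hq'⟩ := h.isOrderBasis.mem_iff.mp (mem_unitGroup.mp hy).2
  have hinv : ofCoords R e₁ e₂ e₃ q * ofCoords R e₁ e₂ e₃ q' = 1 := by
    rw [hq, hq', Units.mul_inv]
  obtain ⟨m, hm, hr⟩ := h.exists_mul_eq p q'
  rw [Units.val_mul, ← hp, ← hq', hm, hO', hr, h.red_inverse hinv, TernaryCoeffs.mul_smul,
    Submodule.smul_mem_iff _ (inv_ne_zero (h.norm_ne_zero hinv))]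

/-- The bridge to linear algebra over the residue field: the index and the representatives follow
from one unique-existence statement about reduced coordinates. -/
theorem relIndex_and_isRightCosetReps (hR : maximalIdeal R = Ideal.span {2})
    (h : IsCliffordBasis Q O e₁ e₂ e₃) (h1 : TernaryCoeffs.one ∈ L)
    (hO' : ∀ p, ofCoords R e₁ e₂ e₃ p ∈ O' ↔ red p ∈ L) {ι : Type*}
    {β : ι → B} {τ : ι → Fin 4 → ResidueField R}
    (hβ : ∀ i, ∃ p, ofCoords R e₁ e₂ e₃ p = β i ∧ red p = τ i)
    (hτ : ∀ i, (Q.map (residue R)).norm (τ i) ≠ 0)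
    (huniq : ∀ x, (Q.map (residue R)).norm x ≠ 0 →
      ∃! i, (Q.map (residue R)).mul x ((Q.map (residue R)).conj (τ i)) ∈ L) :
    (unitGroup O').relIndex (unitGroup O) = Nat.card ι ∧
      IsRightCosetReps (unitGroup O') (unitGroup O) (Set.range β) := by
  choose p hp hpτ using hβ
  have hu : ∀ i, ∃ x ∈ unitGroup O, (x : B) = β i := by
    intro i
    rw [← hp i]
    exact h.exists_unit hR (by rw [hpτ]; exact hτ i)
  choose u huO hu using hu
  have key : ∀ x ∈ unitGroup O, ∃! i, x * (u i)⁻¹ ∈ unitGroup O' := by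
    intro x hx
    obtain ⟨q, hq⟩ := h.isOrderBasis.mem_iff.mp (mem_unitGroup.mp hx).1
    obtain ⟨q', hq'⟩ := h.isOrderBasis.mem_iff.mp (mem_unitGroup.mp hx).2
    have hN := h.norm_ne_zero (p := q) (q := q') (by rw [hq, hq', Units.mul_inv])
    have := huniq (red q) hN
    simp only [h.mul_inv_mem_unitGroup_iff h1 hO' hx (huO _) hq ((hp _).trans (hu _).symm), hpτ]
    exact this
  refine ⟨?_, ?_, ?_⟩
  · rw [Subgroup.relIndex, Subgroup.index]
    symm
    -- Mathlib's quotient consists of the classes `x U'`, whereas the representatives are for the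
    -- classes `U' x`; inversion exchanges the two.
    refine Nat.card_eq_of_bijective (fun i =>
      (QuotientGroup.mk (⟨u i, huO i⟩⁻¹ : unitGroup O) :
        unitGroup O ⧸ (unitGroup O').subgroupOf (unitGroup O))) ⟨fun i j hij => ?_, fun x => ?_⟩
    · rw [QuotientGroup.eq, Subgroup.mem_subgroupOf] at hij
      refine (key (u i) (huO i)).unique ?_ (by simpa using hij)
      rw [mul_inv_cancel]
      exact one_mem _
    · obtain ⟨x, rfl⟩ := QuotientGroup.mk_surjective x
      obtain ⟨i, hi, -⟩ := key _ (inv_mem x.2)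
      refine ⟨i, Eq.symm ?_⟩
      rw [QuotientGroup.eq, Subgroup.mem_subgroupOf]
      simpa using hi
  · rintro _ ⟨i, rfl⟩
    exact ⟨u i, huO i, hu i⟩
  · intro x hx
    obtain ⟨i, hi, hun⟩ := key x hx
    refine ⟨β i, ⟨⟨i, rfl⟩, _, hi, ?_⟩, ?_⟩
    · rw [← hu i, ← Units.val_mul, inv_mul_cancel_right]
    · rintro _ ⟨⟨j, rfl⟩, w, hw, hxw⟩
      rw [hun j]
      rw [← hu j, ← Units.val_mul, Units.val_inj] at hxw
      rwa [hxw, mul_inv_cancel_right]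

end IsCliffordBasis

end Local

/-! ### Coset decompositions over the residue field. -/

section ResidueAlgebras

variable {k : Type*} [Field k]

/-- The coordinate vectors with `u x₁ + v x₂ + w x₃ = 0`. -/
def hyperplane (u v w : k) : Submodule k (Fin 4 → k) where
  carrier := {x | u * x 1 + v * x 2 + w * x 3 = 0}
  add_mem' {x y} hx hy := by
    simp only [Set.mem_ofPred_eq, Pi.add_apply] at *
    linear_combination hx + hy
  zero_mem' := by simp
  smul_mem' c x hx := by
    simp only [Set.mem_ofPred_eq, Pi.smul_apply, smul_eq_mul] at *
    linear_combination c * hx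

theorem mem_hyperplane {u v w : k} {x : Fin 4 → k} :
    x ∈ hyperplane u v w ↔ u * x 1 + v * x 2 + w * x 3 = 0 := Iff.rfl

theorem one_mem_hyperplane (u v w : k) : TernaryCoeffs.one ∈ hyperplane u v w := by
  simp [mem_hyperplane, TernaryCoeffs.one]

/-- The pair `(α, β)` is a point of the projective line: `none` handles the point with `α = 0`, and
`some a` the points of slope `a`. The predicate `P` discards slopes that no element of nonzero norm
attains. -/
theorem existsUnique_option {P : k → Prop} {C : Option {a // P a} → Prop} {α β : k}
    (hnone : C none ↔ α = 0) (hsome : ∀ a, C (some a) ↔ β = a * α) (h0 : α = 0 → β ≠ 0)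
    (h1 : α ≠ 0 → P (β / α)) : ∃! i, C i := by
  by_cases h : α = 0
  · refine ⟨none, hnone.mpr h, ?_⟩
    rintro (_ | a) ha
    · rfl
    · rw [hsome, h, mul_zero] at ha
      exact absurd ha (h0 h)
  · refine ⟨some ⟨β / α, h1 h⟩, (hsome _).mpr (div_mul_cancel₀ β h).symm, ?_⟩
    rintro (_ | a) ha
    · exact absurd (hnone.mp ha) h
    · rw [hsome] at ha
      rw [Option.some_inj, Subtype.ext_iff, eq_div_iff h, ha]

theorem existsUnique_subtype {P : k → Prop} {C : {a // P a} → Prop} {α β : k}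
    (hC : ∀ a, C a ↔ β = a * α) (h0 : α ≠ 0) (h1 : P (β / α)) : ∃! i, C i := by
  refine ⟨⟨β / α, h1⟩, (hC _).mpr (div_mul_cancel₀ β h0).symm, fun a ha => ?_⟩
  replace ha := (hC a).mp ha
  rw [Subtype.ext_iff, eq_div_iff h0, ha]

theorem existsUnique_of_iff {C : k → Prop} {α β : k}
    (hC : ∀ a, C a ↔ β = a * α) (h0 : α ≠ 0) : ∃! i, C i := by
  refine ⟨β / α, (hC _).mpr (div_mul_cancel₀ β h0).symm, fun a ha => ?_⟩
  replace ha := (hC a).mp ha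
  rw [eq_div_iff h0, ha]

variable [CharP k 2] (x : Fin 4 → k)

/-- The maximal order: representatives modulo an Eichler order. -/
theorem existsUnique_matrix_borel (hx : TernaryCoeffs.norm ⟨0, 0, 1, 1⟩ x ≠ 0) :
    ∃! i : Option {_a : k // True}, TernaryCoeffs.mul ⟨0, 0, 1, 1⟩ x (TernaryCoeffs.conj ⟨0, 0, 1, 1⟩
      (i.elim ![0, 1, 1, 0] fun a => ![1, 0, a, 0])) ∈ hyperplane 0 1 0 := by
  refine existsUnique_option (α := x 0 + x 3) (β := x 2) ?_ (fun a => ?_) (fun h h' => ?_)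
      (fun h => trivial) <;>
    simp [mem_hyperplane, TernaryCoeffs.mul, TernaryCoeffs.conj, TernaryCoeffs.norm] at * <;> grind

/-- Here the norm factors as `x₀ (x₀ + x₃)`, so `α = x₀ + x₃` never vanishes and no exceptional
representative is needed. -/
theorem existsUnique_triangular_e₂ (hx : TernaryCoeffs.norm ⟨0, 0, 0, 1⟩ x ≠ 0) :
    ∃! a : k, TernaryCoeffs.mul ⟨0, 0, 0, 1⟩ x (TernaryCoeffs.conj ⟨0, 0, 0, 1⟩
      ![1, 0, a, 0]) ∈ hyperplane 0 1 0 := by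
  refine existsUnique_of_iff (α := x 0 + x 3) (β := x 2) (fun a => ?_) (fun h => ?_) <;>
    simp [mem_hyperplane, TernaryCoeffs.mul, TernaryCoeffs.conj, TernaryCoeffs.norm] at * <;> grind

/-- Both factors `x₀` and `x₀ + x₃` of the norm matter: the first makes the slope `x₃ / x₀` finite,
the second keeps it away from 1. -/
theorem existsUnique_triangular_e₃ (hx : TernaryCoeffs.norm ⟨0, 0, 0, 1⟩ x ≠ 0) :
    ∃! a : {a : k // a ≠ 1}, TernaryCoeffs.mul ⟨0, 0, 0, 1⟩ x (TernaryCoeffs.conj ⟨0, 0, 0, 1⟩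
      ![1, 0, 0, a]) ∈ hyperplane 0 0 1 := by
  refine existsUnique_subtype (α := x 0) (β := x 3) (fun a => ?_) (fun h => ?_) ?_ <;>
    simp [mem_hyperplane, TernaryCoeffs.mul, TernaryCoeffs.conj, TernaryCoeffs.norm] at * <;> grind

theorem existsUnique_quadratic_e₁_e₂ (hx : TernaryCoeffs.norm ⟨1, 1, 0, 1⟩ x ≠ 0) :
    ∃! a : k × k, TernaryCoeffs.mul ⟨1, 1, 0, 1⟩ x (TernaryCoeffs.conj ⟨1, 1, 0, 1⟩
      ![1, a.1, a.2, 0]) ∈ hyperplane 1 0 0 ⊓ hyperplane (0 : k) 1 0 := by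
  simp only [Submodule.mem_inf, mem_hyperplane]
  generalize hN : TernaryCoeffs.norm ⟨1, 1, 0, 1⟩ x = N at hx
  simp [TernaryCoeffs.norm] at hN
  -- Cramer's rule for `a x₀ + b x₃ = x₁`, `a x₃ + b (x₀ + x₃) = x₂`, a system whose determinant is
  -- the norm `N`.
  refine ⟨((x 1 * (x 0 + x 3) + x 2 * x 3) / N, (x 0 * x 2 + x 3 * x 1) / N), ?_, ?_⟩
  · simp [TernaryCoeffs.mul, TernaryCoeffs.conj]; grind
  · rintro ⟨a, b⟩
    simp [TernaryCoeffs.mul, TernaryCoeffs.conj, eq_div_iff hx]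
    grind

/-- Only the component `x₀ + x₃ e₃` in the quadratic algebra `k[e₃]` matters, up to scalars. Its
norm is `x₀² + x₀ x₃ + x₃²`, so the excluded slopes are the roots of `a² + a + 1`. -/
theorem existsUnique_quadratic_e₃ (hx : TernaryCoeffs.norm ⟨1, 1, 0, 1⟩ x ≠ 0) :
    ∃! i : Option {a : k // a ^ 2 + a + 1 ≠ 0}, TernaryCoeffs.mul ⟨1, 1, 0, 1⟩ x
      (TernaryCoeffs.conj ⟨1, 1, 0, 1⟩ (i.elim ![0, 0, 0, 1] fun a => ![1, 0, 0, a])) ∈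
        hyperplane 0 0 1 := by
  refine existsUnique_option (α := x 0) (β := x 3) ?_ (fun a => ?_) (fun h h' => ?_)
      (fun h => ?_) <;>
    simp [mem_hyperplane, TernaryCoeffs.mul, TernaryCoeffs.conj, TernaryCoeffs.norm] at * <;> grind

/-- In characteristic 2 the norm is `(x₀ + x₁ + x₂ + x₃)² = (α + β)²`, so `α` and `β` are never
equal; this excludes the slope 1. -/
theorem existsUnique_klein_e₂ (hx : TernaryCoeffs.norm ⟨1, 1, 1, 0⟩ x ≠ 0) :
    ∃! i : Option {a : k // a ≠ 1}, TernaryCoeffs.mul ⟨1, 1, 1, 0⟩ x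
      (TernaryCoeffs.conj ⟨1, 1, 1, 0⟩ (i.elim ![0, 0, 1, 0] fun a => ![1, 0, a, 0])) ∈
        hyperplane 1 1 0 := by
  refine existsUnique_option (α := x 0 + x 3) (β := x 1 + x 2) ?_ (fun a => ?_) (fun h h' => ?_)
      (fun h => ?_) <;>
    simp [mem_hyperplane, TernaryCoeffs.mul, TernaryCoeffs.conj, TernaryCoeffs.norm] at * <;> grind

/-- The norm is `(x₀ + x₃)² = α²`. The value `v = 0` serves the descents B→B with `s ≥ 1`, and `v =
1` the descents B→D. -/
theorem existsUnique_cyclic_e₂ (v : k) (hx : TernaryCoeffs.norm ⟨1, 1, 0, 0⟩ x ≠ 0) :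
    ∃! a : k, TernaryCoeffs.mul ⟨1, 1, 0, 0⟩ x (TernaryCoeffs.conj ⟨1, 1, 0, 0⟩
      ![1, 0, a, 0]) ∈ hyperplane 1 1 v := by
  refine existsUnique_of_iff (α := x 0 + x 3) (β := x 1 + x 2 + v * x 3) (fun a => ?_)
      (fun h => ?_) <;>
    simp [mem_hyperplane, TernaryCoeffs.mul, TernaryCoeffs.conj, TernaryCoeffs.norm] at * <;> grind

theorem existsUnique_cyclic_e₃ (hx : TernaryCoeffs.norm ⟨1, 1, 0, 0⟩ x ≠ 0) :
    ∃! i : Option {a : k // a ≠ 1}, TernaryCoeffs.mul ⟨1, 1, 0, 0⟩ x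
      (TernaryCoeffs.conj ⟨1, 1, 0, 0⟩ (i.elim ![0, 0, 0, 1] fun a => ![1, 0, 0, a])) ∈
        hyperplane 0 0 1 := by
  refine existsUnique_option (α := x 0) (β := x 3) ?_ (fun a => ?_) (fun h h' => ?_)
      (fun h => ?_) <;>
    simp [mem_hyperplane, TernaryCoeffs.mul, TernaryCoeffs.conj, TernaryCoeffs.norm] at * <;> grind

/-- Now `β` is the linear form whose square is the norm, so the slope is never 0, and the
exceptional representative is 1. -/
theorem existsUnique_cyclic_shift (hx : TernaryCoeffs.norm ⟨1, 1, 0, 0⟩ x ≠ 0) :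
    ∃! i : Option {a : k // a ≠ 0}, TernaryCoeffs.mul ⟨1, 1, 0, 0⟩ x
      (TernaryCoeffs.conj ⟨1, 1, 0, 0⟩ (i.elim ![1, 0, 0, 0] fun a => ![a, 0, 1, 0])) ∈
        hyperplane 1 1 0 := by
  refine existsUnique_option (α := x 1 + x 2) (β := x 0 + x 3) ?_ (fun a => ?_) (fun h h' => ?_)
      (fun h => ?_) <;>
    simp [mem_hyperplane, TernaryCoeffs.mul, TernaryCoeffs.conj, TernaryCoeffs.norm] at * <;> grind

/-- The norm is `x₀² = β²`. The value `v = 1` occurs for C→E and C→F with `δ = 1`, and `v = 0` for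
the descents within C, E, F and G. -/
theorem existsUnique_nilpotent_shift_e₂ (v : k) (hx : TernaryCoeffs.norm ⟨1, 0, 0, 0⟩ x ≠ 0) :
    ∃! i : Option {a : k // a ≠ 0}, TernaryCoeffs.mul ⟨1, 0, 0, 0⟩ x
      (TernaryCoeffs.conj ⟨1, 0, 0, 0⟩ (i.elim ![1, 0, 0, 0] fun a => ![a, 0, 1, 0])) ∈
        hyperplane 0 1 v := by
  refine existsUnique_option (α := x 2 + v * x 3) (β := x 0) ?_ (fun a => ?_) (fun h h' => ?_)
      (fun h => ?_) <;>
    simp [mem_hyperplane, TernaryCoeffs.mul, TernaryCoeffs.conj, TernaryCoeffs.norm] at * <;> grind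

theorem existsUnique_nilpotent_shift_e₃ (hx : TernaryCoeffs.norm ⟨1, 0, 0, 0⟩ x ≠ 0) :
    ∃! i : Option {a : k // a ≠ 0}, TernaryCoeffs.mul ⟨1, 0, 0, 0⟩ x
      (TernaryCoeffs.conj ⟨1, 0, 0, 0⟩ (i.elim ![1, 0, 0, 0] fun a => ![a, 0, 0, 1])) ∈
        hyperplane 0 1 1 := by
  refine existsUnique_option (α := x 2 + x 3) (β := x 0) ?_ (fun a => ?_) (fun h h' => ?_)
      (fun h => ?_) <;>
    simp [mem_hyperplane, TernaryCoeffs.mul, TernaryCoeffs.conj, TernaryCoeffs.norm] at * <;> grind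

/-- The plane is `k[ω]` with `ω = e₁ + e₂ + e₃`, of trace and norm 1, a quadratic field inside the
matrix algebra under `hk`. Membership is a linear system in the two parameters with determinant the
norm of `x`. -/
theorem existsUnique_matrix_field (hk : ∀ b : k, b ^ 2 + b + 1 ≠ 0)
    (hx : TernaryCoeffs.norm ⟨0, 0, 1, 1⟩ x ≠ 0) :
    ∃! i : k × {b : k // b ≠ 0}, TernaryCoeffs.mul ⟨0, 0, 1, 1⟩ x
      (TernaryCoeffs.conj ⟨0, 0, 1, 1⟩ ![0, 1, i.2, i.1]) ∈
        hyperplane 1 1 0 ⊓ hyperplane (0 : k) 1 1 := by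
  simp only [Submodule.mem_inf, mem_hyperplane]
  generalize hN : TernaryCoeffs.norm ⟨0, 0, 1, 1⟩ x = N at hx
  simp [TernaryCoeffs.norm] at hN
  -- This is the numerator of `b` in Cramer's rule. It is the norm of `x₀ + x₂ ω` from `k[ω]`, which
  -- is anisotropic by `hk`; if `x₀ = x₂ = 0`, then `x` would have norm 0.
  have hb : x 0 ^ 2 + x 0 * x 2 + x 2 ^ 2 ≠ 0 := by
    intro h
    by_cases h2 : x 2 = 0
    · grind
    · apply hk (x 0 / x 2)
      field_simp
      linear_combination h
  refine ⟨((x 0 * x 1 + (x 0 + x 2) * (x 0 + x 3)) / N,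
    ⟨(x 0 ^ 2 + x 0 * x 2 + x 2 ^ 2) / N, div_ne_zero hb hx⟩), ?_, ?_⟩
  · simp [TernaryCoeffs.mul, TernaryCoeffs.conj]; grind
  · rintro ⟨a, b, hb⟩
    simp [TernaryCoeffs.mul, TernaryCoeffs.conj, eq_div_iff hx]
    grind

/-- For the first family, membership is a linear system in `(a, b)` whose determinant is the form
`u² + u v + v²` at `(x₁, x₀ + x₃)`. That form can be isotropic, and the second family covers exactly
its zeros. No assumption on the roots of `b² + b + 1` is needed: without roots the second family is
empty. -/
theorem existsUnique_matrix_split (hx : TernaryCoeffs.norm ⟨0, 0, 1, 1⟩ x ≠ 0) :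
    ∃! i : k × {b : k // b ≠ 0} ⊕ k × {b : k // b ^ 2 + b + 1 = 0},
      TernaryCoeffs.mul ⟨0, 0, 1, 1⟩ x (TernaryCoeffs.conj ⟨0, 0, 1, 1⟩
        (i.elim (fun i => ![i.1, 1, i.2, -i.1])
          fun i => ![i.1 + i.2, 1, i.1 * i.2, -i.1])) ∈
        hyperplane 1 1 0 ⊓ hyperplane (0 : k) 1 1 := by
  simp only [Submodule.mem_inf, mem_hyperplane]
  simp [TernaryCoeffs.norm] at hx
  by_cases hD : x 1 ^ 2 + x 1 * (x 0 + x 3) + (x 0 + x 3) ^ 2 = 0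
  · have h1 : x 1 ≠ 0 := by
      intro h1
      have : x 0 + x 3 = 0 := by simpa [h1] using hD
      grind
    -- At a zero of the determinant, this ratio is the parameter `b` of the second family.
    have hb : ((x 0 + x 3) / x 1) ^ 2 + (x 0 + x 3) / x 1 + 1 = 0 := by
      field_simp
      linear_combination hD
    generalize hb' : (x 0 + x 3) / x 1 = b at hb
    rw [div_eq_iff h1] at hb'
    have hb0 : b ≠ 0 := by rintro rfl; simp at hb
    refine ⟨Sum.inr ((x 0 + b * x 1 + b * x 2) / (b * x 1), ⟨b, hb⟩), ?_, ?_⟩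
    · simp [TernaryCoeffs.mul, TernaryCoeffs.conj]; grind
    · rintro (⟨a, c, hc⟩ | ⟨a, c, hc⟩)
      · simp [TernaryCoeffs.mul, TernaryCoeffs.conj]; grind
      · simp [TernaryCoeffs.mul, TernaryCoeffs.conj, eq_div_iff (mul_ne_zero hb0 h1)]; grind
  · generalize hD' : x 1 ^ 2 + x 1 * (x 0 + x 3) + (x 0 + x 3) ^ 2 = D at hD
    -- Cramer's rule with determinant `D`. In characteristic 2 the numerator of `b` is the norm of
    -- `x`, hence nonzero.
    refine ⟨Sum.inl ((x 0 * x 1 + (x 0 + x 3) * (x 0 + x 2)) / D,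
      ⟨(x 1 * x 2 + x 0 * (x 0 + x 3)) / D, div_ne_zero (by grind) hD⟩), ?_, ?_⟩
    · simp [TernaryCoeffs.mul, TernaryCoeffs.conj]; grind
    · rintro (⟨a, c, hc⟩ | ⟨a, c, hc⟩)
      · simp [TernaryCoeffs.mul, TernaryCoeffs.conj, eq_div_iff hD]; grind
      · simp [TernaryCoeffs.mul, TernaryCoeffs.conj]; grind

end ResidueAlgebras

/-! ### Cardinalities of the parameter sets. -/

section Counting

theorem card_subtype_not {α : Type*} [Finite α] (p : α → Prop) :
    Nat.card {a // ¬ p a} = Nat.card α - Nat.card {a // p a} := by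
  classical
  have := Fintype.ofFinite α
  simp only [Nat.card_eq_fintype_card]
  exact Fintype.card_subtype_compl p

theorem card_subtype_ne {α : Type*} [Finite α] (c : α) :
    Nat.card {a // a ≠ c} = Nat.card α - 1 := by
  rw [card_subtype_not, Nat.card_unique (α := {a // a = c})]

theorem card_option_ne {α : Type*} [Finite α] (c : α) :
    Nat.card (Option {a // a ≠ c}) = Nat.card α := by
  have : Nonempty α := ⟨c⟩
  rw [Finite.card_option, card_subtype_ne, Nat.sub_add_cancel Nat.card_pos]

theorem two_pow_mod_three_eq_one_iff (r : ℕ) : 2 ^ r % 3 = 1 ↔ Even r := by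
  rcases Nat.even_or_odd' r with ⟨m, rfl | rfl⟩
  · simp [pow_mul, Nat.pow_mod]
  · simp [pow_succ, pow_mul, Nat.mul_mod, Nat.pow_mod]

variable {k : Type*} [Field k] [Finite k] [CharP k 2] {r : ℕ}

/-- The roots are the elements of order 3 in `kˣ`; by Lagrange and Cauchy they exist if and only if
3 divides `2 ^ r - 1`. -/
theorem exists_primitive_cube_root_iff (hr : Nat.card k = 2 ^ r) :
    (∃ b : k, b ^ 2 + b + 1 = 0) ↔ Even r := by
  have hcard : Nat.card kˣ = 2 ^ r - 1 := by rw [Nat.card_units, hr]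
  have hpos : 0 < 2 ^ r := by positivity
  rw [← two_pow_mod_three_eq_one_iff]
  constructor
  · rintro ⟨b, hb⟩
    have hb3 : b ^ 3 = 1 := by linear_combination (b - 1) * hb
    have hu : (Units.ofPowEqOne b 3 hb3 (by norm_num)) ^ 3 = 1 := by
      ext; simp
    have hu1 : Units.ofPowEqOne b 3 hb3 (by norm_num) ≠ 1 := by
      intro h
      have hb1 : b = 1 := by simpa using congrArg Units.val h
      subst hb1
      grind
    have hdvd : 3 ∣ Nat.card kˣ := by
      rw [← orderOf_eq_prime hu hu1]
      exact orderOf_dvd_natCard _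
    omega
  · intro h
    have : Fact (Nat.Prime 3) := ⟨Nat.prime_three⟩
    obtain ⟨u, hu⟩ := exists_prime_orderOf_dvd_card' (G := kˣ) 3 (by omega)
    have hu3 : (u : k) ^ 3 = 1 := by
      rw [← Units.val_pow_eq_pow_val, ← hu, pow_orderOf_eq_one, Units.val_one]
    have hu1 : (u : k) - 1 ≠ 0 := by
      intro h1
      have : u = 1 := by ext; simpa [sub_eq_zero] using h1
      rw [this, orderOf_one] at hu
      norm_num at hu
    refine ⟨u, mul_left_cancel₀ hu1 ?_⟩
    linear_combination hu3

theorem card_primitive_cube_roots_of_even (hr : Nat.card k = 2 ^ r) (h : Even r) :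
    Nat.card {b : k // b ^ 2 + b + 1 = 0} = 2 := by
  obtain ⟨b, hb⟩ := (exists_primitive_cube_root_iff hr).mpr h
  have : {b : k | b ^ 2 + b + 1 = 0} = {b, b + 1} := by
    ext a
    simp only [Set.mem_ofPred_eq, Set.mem_insert_iff, Set.mem_singleton_iff]
    refine ⟨fun ha => ?_, by grind⟩
    have : (a - b) * (a - (b + 1)) = 0 := by grind
    rcases mul_eq_zero.mp this with h | h
    · exact Or.inl (sub_eq_zero.mp h)
    · exact Or.inr (sub_eq_zero.mp h)
  change Nat.card {b : k | b ^ 2 + b + 1 = 0} = 2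
  rw [this, Nat.card_coe_set_eq, Set.ncard_pair (by simp)]

theorem card_option_not_primitive_cube_root (hr : Nat.card k = 2 ^ r) :
    Nat.card (Option {b : k // b ^ 2 + b + 1 ≠ 0}) =
      if Even r then 2 ^ r - 1 else 2 ^ r + 1 := by
  rw [Finite.card_option, card_subtype_not, hr]
  split_ifs with h
  · rw [card_primitive_cube_roots_of_even hr h]
    obtain ⟨b, hb⟩ := (exists_primitive_cube_root_iff hr).mpr h
    -- Needed for the truncated subtraction: `q - 2 + 1 = q - 1` requires `q ≥ 2`.
    have := (Finite.one_lt_card : 1 < Nat.card k)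
    omega
  · have : IsEmpty {b : k // b ^ 2 + b + 1 = 0} :=
      ⟨fun b => h ((exists_primitive_cube_root_iff hr).mp ⟨b, b.2⟩)⟩
    simp

end Counting

/-! ### Suborders as preimages of subspaces modulo 2. -/

section Suborder

variable {R : Type*} [CommRing R]

/-- The determinant of the last three coordinates. -/
def det3 (x y z : Fin 4 → R) : R :=
  x 1 * (y 2 * z 3 - y 3 * z 2) - x 2 * (y 1 * z 3 - y 3 * z 1) + x 3 * (y 1 * z 2 - y 2 * z 1)

/-- Cramer's rule. Three coordinates suffice because 1 belongs to the lattice and absorbs the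
remaining one. -/
theorem det3_smul_eq (x y z p : Fin 4 → R) :
    det3 x y z • p = (det3 x y z * p 0 - det3 p y z * x 0 - det3 x p z * y 0 - det3 x y p * z 0) •
      TernaryCoeffs.one + det3 p y z • x + det3 x p z • y + det3 x y p • z := by
  ext i
  fin_cases i <;>
    simp only [Pi.add_apply, Pi.smul_apply, smul_eq_mul, det3, TernaryCoeffs.one, Fin.zero_eta,
      Fin.mk_one, Fin.reduceFinMk, Matrix.cons_val] <;> ring

theorem mem_span_four {M : Type*} [AddCommGroup M] [Module R M] {w x y z p : M} :
    p ∈ Submodule.span R {w, x, y, z} ↔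
      ∃ a b c d : R, p = a • w + b • x + c • y + d • z := by
  simp only [Submodule.mem_span_insert, Submodule.mem_span_singleton]
  constructor
  · rintro ⟨a, _, ⟨b, _, ⟨c, _, ⟨d, rfl⟩, rfl⟩, rfl⟩, rfl⟩
    exact ⟨a, b, c, d, by abel⟩
  · rintro ⟨a, b, c, d, rfl⟩
    exact ⟨a, _, ⟨b, _, ⟨c, _, ⟨d, rfl⟩, rfl⟩, rfl⟩, by abel⟩

variable [IsLocalRing R]

/-- The factor `n` clears the denominators that the values of the `μᵢ²` bring into the determinant.
-/
theorem two_smul_mem_span_of_det {x y z : Fin 4 → R} {n v : R} (hv : residue R v ≠ 0)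
    (h : n * det3 x y z = 2 * v) (p : Fin 4 → R) :
    (2 : R) • p ∈ Submodule.span R {TernaryCoeffs.one, x, y, z} := by
  have hu : IsUnit v := by
    rwa [← not_not (a := IsUnit v), ← mem_nonunits_iff, ← IsLocalRing.mem_maximalIdeal,
      ← IsLocalRing.residue_eq_zero_iff]
  rw [← Submodule.smul_mem_iff_of_isUnit _ hu, smul_smul, mul_comm v 2, ← h, mul_smul]
  refine Submodule.smul_mem _ _ (mem_span_four.mpr ⟨_, _, _, _, det3_smul_eq x y z p⟩)

/-- The version for suborders with two generators divisible by 2, where `L` is a plane. -/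
theorem two_smul_mem_span_of_det_unit {x y z : Fin 4 → R} {v : R} (hv : residue R v ≠ 0)
    (h : det3 x y z = v) (p : Fin 4 → R) :
    (2 : R) • p ∈ Submodule.span R {TernaryCoeffs.one, (2 : R) • x, (2 : R) • y, z} := by
  have hu : IsUnit v := by
    rwa [← not_not (a := IsUnit v), ← mem_nonunits_iff, ← IsLocalRing.mem_maximalIdeal,
      ← IsLocalRing.residue_eq_zero_iff]
  rw [← Submodule.smul_mem_iff_of_isUnit _ hu, smul_smul, mul_comm v 2, ← h, mul_smul,
    det3_smul_eq]
  exact mem_span_four.mpr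
    ⟨2 * (det3 x y z * p 0 - det3 p y z * x 0 - det3 x p z * y 0 - det3 x y p * z 0),
      det3 p y z, det3 x p z, 2 * det3 x y p, by module⟩

variable {B : Type*} [Ring B] [Algebra R B] {O O' : Subalgebra R B} {e₁ e₂ e₃ : B}

/-- Hypothesis `h2` says that the lattice contains `2O`, so membership can be tested modulo 2. -/
theorem IsOrderBasis.mem_suborder_iff (hR : maximalIdeal R = Ideal.span {2})
    (h : IsOrderBasis O e₁ e₂ e₃) {x y z : Fin 4 → R}
    {L : Submodule (ResidueField R) (Fin 4 → ResidueField R)}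
    (hL : L = Submodule.span (ResidueField R) {TernaryCoeffs.one, red x, red y, red z})
    (h2 : ∀ p : Fin 4 → R, (2 : R) • p ∈ Submodule.span R {TernaryCoeffs.one, x, y, z})
    (hO' : Subalgebra.toSubmodule O' = Submodule.span R {1, ofCoords R e₁ e₂ e₃ x,
      ofCoords R e₁ e₂ e₃ y, ofCoords R e₁ e₂ e₃ z}) (p : Fin 4 → R) :
    ofCoords R e₁ e₂ e₃ p ∈ O' ↔ red p ∈ L := by
  have hmap : Subalgebra.toSubmodule O' =
      (Submodule.span R {TernaryCoeffs.one, x, y, z}).map (ofCoords R e₁ e₂ e₃) := by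
    rw [hO', Submodule.map_span]
    simp only [Set.image_insert_eq, Set.image_singleton, ofCoords_one]
  rw [← Subalgebra.mem_toSubmodule, hmap, Submodule.mem_map,
    (by simp [h.injective.eq_iff] : (∃ q ∈ Submodule.span R {TernaryCoeffs.one, x, y, z},
      ofCoords R e₁ e₂ e₃ q = ofCoords R e₁ e₂ e₃ p) ↔ p ∈ Submodule.span R
        {TernaryCoeffs.one, x, y, z}), hL, mem_span_four, mem_span_four]
  constructor
  · rintro ⟨a, b, c, d, rfl⟩
    exact ⟨residue R a, residue R b, residue R c, residue R d, by
      simp only [red_add, red_smul, red_one]⟩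
  · rintro ⟨a, b, c, d, hp⟩
    obtain ⟨a, rfl⟩ := IsLocalRing.residue_surjective a
    obtain ⟨b, rfl⟩ := IsLocalRing.residue_surjective b
    obtain ⟨c, rfl⟩ := IsLocalRing.residue_surjective c
    obtain ⟨d, rfl⟩ := IsLocalRing.residue_surjective d
    simp only [← red_smul, ← red_one, ← red_add] at hp
    obtain ⟨q, rfl⟩ := exists_eq_add_of_red_eq hR hp
    exact mem_span_four.mp (add_mem (mem_span_four.mpr ⟨a, b, c, d, rfl⟩) (h2 q))

end Suborder

/-! ### Lifting the coset decompositions to the orders. -/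

section Cosets

variable {R : Type*} [CommRing R] [IsLocalRing R]

theorem exists_residue_section {S : Set R} (hS : Set.BijOn (residue R) S Set.univ) :
    ∃ σ : ResidueField R → R, (∀ a, σ a ∈ S) ∧ (∀ a, residue R (σ a) = a) ∧
      ∀ s ∈ S, σ (residue R s) = s := by
  choose σ hσS hσ using fun a => hS.surjOn (Set.mem_univ a)
  exact ⟨σ, hσS, hσ, fun s hs => hS.injOn (hσS _) hs (hσ _)⟩

theorem charP_residueField (hR : maximalIdeal R = Ideal.span {2}) : CharP (ResidueField R) 2 :=
  CharTwo.of_one_ne_zero_of_two_eq_zero one_ne_zero ((map_ofNat (residue R) 2).symm.trans (residue_two hR))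

variable {B : Type*} [Ring B] [Algebra R B] {O O' : Subalgebra R B} {e₁ e₂ e₃ : B}
  {Q : TernaryCoeffs R} {q : TernaryCoeffs (ResidueField R)}
  {L : Submodule (ResidueField R) (Fin 4 → ResidueField R)} {S : Set R}

namespace IsCliffordBasis

theorem cosets_option (hR : maximalIdeal R = Ideal.span {2}) (h : IsCliffordBasis Q O e₁ e₂ e₃)
    (hQ : Q.map (residue R) = q) (h1 : TernaryCoeffs.one ∈ L)
    (hO' : ∀ p, ofCoords R e₁ e₂ e₃ p ∈ O' ↔ red p ∈ L)
    (hS : Set.BijOn (residue R) S Set.univ) {P : ResidueField R → Prop} {b : B} {f : R → B}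
    {τ₀ : Fin 4 → ResidueField R} {τ : ResidueField R → Fin 4 → ResidueField R}
    (hb : ∃ p, ofCoords R e₁ e₂ e₃ p = b ∧ red p = τ₀)
    (hf : ∀ a, ∃ p, ofCoords R e₁ e₂ e₃ p = f a ∧ red p = τ (residue R a))
    (hτ₀ : q.norm τ₀ ≠ 0) (hτ : ∀ a, P a → q.norm (τ a) ≠ 0)
    (huniq : ∀ x, q.norm x ≠ 0 →
      ∃! i : Option {a // P a}, q.mul x (q.conj (i.elim τ₀ fun a => τ a)) ∈ L) :
    (unitGroup O').relIndex (unitGroup O) = Nat.card (Option {a // P a}) ∧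
      IsRightCosetReps (unitGroup O') (unitGroup O)
        ({b} ∪ {x | ∃ a ∈ S, P (residue R a) ∧ x = f a}) := by
  subst hQ
  obtain ⟨σ, hσS, hσ, hSσ⟩ := exists_residue_section hS
  have hrange : {b} ∪ {x | ∃ a ∈ S, P (residue R a) ∧ x = f a} =
      Set.range (fun i : Option {a // P a} => i.elim b fun a => f (σ a)) := by
    ext x
    simp only [Set.mem_union, Set.mem_singleton_iff, Set.mem_ofPred_eq, Set.mem_range,
      Option.exists, Option.elim, Subtype.exists]
    constructor
    · rintro (rfl | ⟨a, ha, hP, rfl⟩)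
      · exact Or.inl rfl
      · exact Or.inr ⟨residue R a, hP, by rw [hSσ a ha]⟩
    · rintro (rfl | ⟨a, hP, rfl⟩)
      · exact Or.inl rfl
      · exact Or.inr ⟨σ a, hσS a, by rwa [hσ], rfl⟩
  rw [hrange]
  refine h.relIndex_and_isRightCosetReps hR h1 hO' ?_ ?_ huniq
  · rintro (_ | a)
    · exact hb
    · obtain ⟨p, hp, hp'⟩ := hf (σ a)
      exact ⟨p, hp, hp'.trans (congrArg τ (hσ a))⟩
  · rintro (_ | a)
    · exact hτ₀
    · exact hτ a a.2

theorem cosets_subtype (hR : maximalIdeal R = Ideal.span {2}) (h : IsCliffordBasis Q O e₁ e₂ e₃)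
    (hQ : Q.map (residue R) = q) (h1 : TernaryCoeffs.one ∈ L)
    (hO' : ∀ p, ofCoords R e₁ e₂ e₃ p ∈ O' ↔ red p ∈ L)
    (hS : Set.BijOn (residue R) S Set.univ) {P : ResidueField R → Prop} {f : R → B}
    {τ : ResidueField R → Fin 4 → ResidueField R}
    (hf : ∀ a, ∃ p, ofCoords R e₁ e₂ e₃ p = f a ∧ red p = τ (residue R a))
    (hτ : ∀ a, P a → q.norm (τ a) ≠ 0)
    (huniq : ∀ x, q.norm x ≠ 0 → ∃! i : {a // P a}, q.mul x (q.conj (τ i)) ∈ L) :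
    (unitGroup O').relIndex (unitGroup O) = Nat.card {a // P a} ∧
      IsRightCosetReps (unitGroup O') (unitGroup O)
        {x | ∃ a ∈ S, P (residue R a) ∧ x = f a} := by
  subst hQ
  obtain ⟨σ, hσS, hσ, hSσ⟩ := exists_residue_section hS
  have hrange : {x | ∃ a ∈ S, P (residue R a) ∧ x = f a} =
      Set.range (fun a : {a // P a} => f (σ a)) := by
    ext x
    simp only [Set.mem_ofPred_eq, Set.mem_range, Subtype.exists]
    constructor
    · rintro ⟨a, ha, hP, rfl⟩
      exact ⟨residue R a, hP, by rw [hSσ a ha]⟩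
    · rintro ⟨a, hP, rfl⟩
      exact ⟨σ a, hσS a, by rwa [hσ], rfl⟩
  rw [hrange]
  exact h.relIndex_and_isRightCosetReps hR h1 hO' (fun a => by simpa only [hσ] using hf (σ a))
    (fun a => hτ a a.2) huniq

theorem cosets_all (hR : maximalIdeal R = Ideal.span {2}) (h : IsCliffordBasis Q O e₁ e₂ e₃)
    (hQ : Q.map (residue R) = q) (h1 : TernaryCoeffs.one ∈ L)
    (hO' : ∀ p, ofCoords R e₁ e₂ e₃ p ∈ O' ↔ red p ∈ L)
    (hS : Set.BijOn (residue R) S Set.univ) {f : R → B}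
    {τ : ResidueField R → Fin 4 → ResidueField R}
    (hf : ∀ a, ∃ p, ofCoords R e₁ e₂ e₃ p = f a ∧ red p = τ (residue R a))
    (hτ : ∀ a, q.norm (τ a) ≠ 0)
    (huniq : ∀ x, q.norm x ≠ 0 → ∃! a, q.mul x (q.conj (τ a)) ∈ L) :
    (unitGroup O').relIndex (unitGroup O) = Nat.card (ResidueField R) ∧
      IsRightCosetReps (unitGroup O') (unitGroup O) {x | ∃ a ∈ S, x = f a} := by
  subst hQ
  obtain ⟨σ, hσS, hσ, hSσ⟩ := exists_residue_section hS
  have hrange : {x | ∃ a ∈ S, x = f a} = Set.range (fun a => f (σ a)) := by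
    ext x
    simp only [Set.mem_ofPred_eq, Set.mem_range]
    constructor
    · rintro ⟨a, ha, rfl⟩
      exact ⟨residue R a, by rw [hSσ a ha]⟩
    · rintro ⟨a, rfl⟩
      exact ⟨σ a, hσS a, rfl⟩
  rw [hrange]
  exact h.relIndex_and_isRightCosetReps hR h1 hO' (fun a => by simpa only [hσ] using hf (σ a))
    hτ huniq

theorem exists_coords (h : IsCliffordBasis Q O e₁ e₂ e₃) (hQ : Q.map (residue R) = q)
    {x y : B} {τ υ : Fin 4 → ResidueField R} (hx : ∃ p, ofCoords R e₁ e₂ e₃ p = x ∧ red p = τ)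
    (hy : ∃ p, ofCoords R e₁ e₂ e₃ p = y ∧ red p = υ) :
    ∃ p, ofCoords R e₁ e₂ e₃ p = x * y ∧ red p = q.mul τ υ := by
  obtain ⟨p, rfl, rfl⟩ := hx
  obtain ⟨p', rfl, rfl⟩ := hy
  obtain ⟨m, hm, hr⟩ := h.exists_mul_eq p p'
  exact ⟨m, hm.symm, by rw [hr, hQ]⟩

end IsCliffordBasis

theorem exists_coords_of_eq {x : B} {τ : Fin 4 → ResidueField R} (p : Fin 4 → R)
    (hx : p 0 • (1 : B) + p 1 • e₁ + p 2 • e₂ + p 3 • e₃ = x)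
    (hτ : ∀ i, residue R (p i) = τ i) : ∃ p, ofCoords R e₁ e₂ e₃ p = x ∧ red p = τ :=
  ⟨p, (ofCoords_apply _ _ _ _).trans hx, funext hτ⟩

theorem coords_one_add_smul_e₂ (a : R) : ∃ p, ofCoords R e₁ e₂ e₃ p = 1 + a • e₂ ∧
    red p = ![1, 0, residue R a, 0] :=
  exists_coords_of_eq ![1, 0, a, 0] (by simp) (by simp [Fin.forall_fin_succ])

theorem coords_one_add_smul_e₃ (a : R) : ∃ p, ofCoords R e₁ e₂ e₃ p = 1 + a • e₃ ∧
    red p = ![1, 0, 0, residue R a] :=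
  exists_coords_of_eq ![1, 0, 0, a] (by simp) (by simp [Fin.forall_fin_succ])

theorem coords_smul_one_add_e₂ (a : R) : ∃ p, ofCoords R e₁ e₂ e₃ p = a • (1 : B) + e₂ ∧
    red p = ![residue R a, 0, 1, 0] :=
  exists_coords_of_eq ![a, 0, 1, 0] (by simp) (by simp [Fin.forall_fin_succ])

theorem coords_smul_one_add_e₃ (a : R) : ∃ p, ofCoords R e₁ e₂ e₃ p = a • (1 : B) + e₃ ∧
    red p = ![residue R a, 0, 0, 1] :=
  exists_coords_of_eq ![a, 0, 0, 1] (by simp) (by simp [Fin.forall_fin_succ])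

theorem coords_one : ∃ p, ofCoords R e₁ e₂ e₃ p = 1 ∧ red p = ![1, 0, 0, 0] :=
  exists_coords_of_eq ![1, 0, 0, 0] (by simp) (by simp [Fin.forall_fin_succ])

theorem coords_e₂ : ∃ p, ofCoords R e₁ e₂ e₃ p = e₂ ∧ red p = ![0, 0, 1, 0] :=
  exists_coords_of_eq ![0, 0, 1, 0] (by simp) (by simp [Fin.forall_fin_succ])

theorem coords_e₃ : ∃ p, ofCoords R e₁ e₂ e₃ p = e₃ ∧ red p = ![0, 0, 0, 1] :=
  exists_coords_of_eq ![0, 0, 0, 1] (by simp) (by simp [Fin.forall_fin_succ])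

theorem coords_e₁_add_smul_e₂ (b : R) : ∃ p, ofCoords R e₁ e₂ e₃ p = e₁ + b • e₂ ∧
    red p = ![0, 1, residue R b, 0] :=
  exists_coords_of_eq ![0, 1, b, 0] (by simp) (by simp [Fin.forall_fin_succ])

theorem coords_smul_one_add_e₁ (b : R) : ∃ p, ofCoords R e₁ e₂ e₃ p = b • (1 : B) + e₁ ∧
    red p = ![residue R b, 1, 0, 0] :=
  exists_coords_of_eq ![b, 1, 0, 0] (by simp) (by simp [Fin.forall_fin_succ])

namespace IsCliffordBasis

variable {r : ℕ}

theorem cosets_triangular_e₂ (hR : maximalIdeal R = Ideal.span {2})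
    (h : IsCliffordBasis Q O e₁ e₂ e₃) (hr : Nat.card (ResidueField R) = 2 ^ r)
    (hQ : Q.map (residue R) = ⟨0, 0, 0, 1⟩)
    (hO' : ∀ p, ofCoords R e₁ e₂ e₃ p ∈ O' ↔ red p ∈ hyperplane 0 1 0)
    (hS : Set.BijOn (residue R) S Set.univ) :
    (unitGroup O').relIndex (unitGroup O) = 2 ^ r ∧
      IsRightCosetReps (unitGroup O') (unitGroup O) {x | ∃ a ∈ S, x = 1 + a • e₂} := by
  have := charP_residueField hR
  rw [← hr]
  exact h.cosets_all hR hQ (one_mem_hyperplane _ _ _) hO' hS coords_one_add_smul_e₂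
    (τ := fun a => ![1, 0, a, 0]) (by simp [TernaryCoeffs.norm]) existsUnique_triangular_e₂

theorem cosets_cyclic_e₂ (hR : maximalIdeal R = Ideal.span {2})
    (h : IsCliffordBasis Q O e₁ e₂ e₃) (hr : Nat.card (ResidueField R) = 2 ^ r)
    (hQ : Q.map (residue R) = ⟨1, 1, 0, 0⟩) {v : ResidueField R}
    (hO' : ∀ p, ofCoords R e₁ e₂ e₃ p ∈ O' ↔ red p ∈ hyperplane 1 1 v)
    (hS : Set.BijOn (residue R) S Set.univ) :
    (unitGroup O').relIndex (unitGroup O) = 2 ^ r ∧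
      IsRightCosetReps (unitGroup O') (unitGroup O) {x | ∃ a ∈ S, x = 1 + a • e₂} := by
  have := charP_residueField hR
  rw [← hr]
  exact h.cosets_all hR hQ (one_mem_hyperplane _ _ _) hO' hS coords_one_add_smul_e₂
    (τ := fun a => ![1, 0, a, 0]) (by simp [TernaryCoeffs.norm])
    fun x => existsUnique_cyclic_e₂ x v

theorem cosets_quadratic_e₁_e₂ (hR : maximalIdeal R = Ideal.span {2})
    (h : IsCliffordBasis Q O e₁ e₂ e₃) (hr : Nat.card (ResidueField R) = 2 ^ r)
    (hQ : Q.map (residue R) = ⟨1, 1, 0, 1⟩)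
    (hO' : ∀ p, ofCoords R e₁ e₂ e₃ p ∈ O' ↔ red p ∈ hyperplane 1 0 0 ⊓ hyperplane 0 1 0)
    (hS : Set.BijOn (residue R) S Set.univ) :
    (unitGroup O').relIndex (unitGroup O) = (2 ^ r) ^ 2 ∧
      IsRightCosetReps (unitGroup O') (unitGroup O)
        {x | ∃ a ∈ S, ∃ b ∈ S, x = 1 + a • e₁ + b • e₂} := by
  have := charP_residueField hR
  obtain ⟨σ, hσS, hσ, hSσ⟩ := exists_residue_section hS
  have hrange : {x | ∃ a ∈ S, ∃ b ∈ S, x = 1 + a • e₁ + b • e₂} =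
      Set.range (fun i : ResidueField R × ResidueField R => 1 + σ i.1 • e₁ + σ i.2 • e₂) := by
    ext x
    constructor
    · rintro ⟨a, ha, b, hb, rfl⟩
      exact ⟨(residue R a, residue R b), by simp only [hSσ a ha, hSσ b hb]⟩
    · rintro ⟨i, rfl⟩
      exact ⟨_, hσS _, _, hσS _, rfl⟩
  rw [hrange, sq, ← hr, ← Nat.card_prod]
  refine h.relIndex_and_isRightCosetReps hR (Submodule.mem_inf.mpr
    ⟨one_mem_hyperplane _ _ _, one_mem_hyperplane _ _ _⟩) hO'
    (τ := fun i => ![1, i.1, i.2, 0]) (fun i => ?_) ?_ ?_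
  · exact exists_coords_of_eq ![1, σ i.1, σ i.2, 0] (by simp) (by simp [Fin.forall_fin_succ, hσ])
  · simp [hQ, TernaryCoeffs.norm]
  · rw [hQ]
    exact existsUnique_quadratic_e₁_e₂

variable [Finite (ResidueField R)]

theorem cosets_matrix_borel (hR : maximalIdeal R = Ideal.span {2})
    (h : IsCliffordBasis Q O e₁ e₂ e₃) (hr : Nat.card (ResidueField R) = 2 ^ r)
    (hQ : Q.map (residue R) = ⟨0, 0, 1, 1⟩)
    (hO' : ∀ p, ofCoords R e₁ e₂ e₃ p ∈ O' ↔ red p ∈ hyperplane 0 1 0)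
    (hS : Set.BijOn (residue R) S Set.univ) :
    (unitGroup O').relIndex (unitGroup O) = 2 ^ r + 1 ∧
      IsRightCosetReps (unitGroup O') (unitGroup O)
        ({e₁ + e₂} ∪ {x | ∃ a ∈ S, x = 1 + a • e₂}) := by
  have := charP_residueField hR
  -- No slope is excluded here; the trivial predicate fits this case into the general pattern of the
  -- projective line, with `q + 1` points.
  have key := h.cosets_option hR hQ (one_mem_hyperplane _ _ _) hO' hS (P := fun _ => True)
    (by simpa using coords_e₁_add_smul_e₂ (R := R) (e₁ := e₁) (e₂ := e₂) (e₃ := e₃) 1)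
    coords_one_add_smul_e₂ (τ := fun a => ![1, 0, a, 0]) (by simp [TernaryCoeffs.norm])
    (by simp [TernaryCoeffs.norm]) existsUnique_matrix_borel
  have hcard : Nat.card {_a : ResidueField R // True} = 2 ^ r := by
    rw [Nat.card_congr (Equiv.subtypeUnivEquiv fun _ => trivial), hr]
  simpa [Finite.card_option, hcard] using key

theorem cosets_triangular_e₃ (hR : maximalIdeal R = Ideal.span {2})
    (h : IsCliffordBasis Q O e₁ e₂ e₃) (hr : Nat.card (ResidueField R) = 2 ^ r)
    (hQ : Q.map (residue R) = ⟨0, 0, 0, 1⟩)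
    (hO' : ∀ p, ofCoords R e₁ e₂ e₃ p ∈ O' ↔ red p ∈ hyperplane 0 0 1)
    (hS : Set.BijOn (residue R) S Set.univ) :
    (unitGroup O').relIndex (unitGroup O) = 2 ^ r - 1 ∧
      IsRightCosetReps (unitGroup O') (unitGroup O)
        {x | ∃ a ∈ S, residue R a ≠ 1 ∧ x = 1 + a • e₃} := by
  have := charP_residueField hR
  rw [← hr, ← card_subtype_ne (1 : ResidueField R)]
  exact h.cosets_subtype hR hQ (one_mem_hyperplane _ _ _) hO' hS (P := fun a => a ≠ 1)
    coords_one_add_smul_e₃ (τ := fun a => ![1, 0, 0, a])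
    (by simp [TernaryCoeffs.norm]; grind) existsUnique_triangular_e₃

theorem cosets_quadratic_e₃ (hR : maximalIdeal R = Ideal.span {2})
    (h : IsCliffordBasis Q O e₁ e₂ e₃) (hr : Nat.card (ResidueField R) = 2 ^ r)
    (hQ : Q.map (residue R) = ⟨1, 1, 0, 1⟩)
    (hO' : ∀ p, ofCoords R e₁ e₂ e₃ p ∈ O' ↔ red p ∈ hyperplane 0 0 1)
    (hS : Set.BijOn (residue R) S Set.univ) :
    (unitGroup O').relIndex (unitGroup O) = (if Even r then 2 ^ r - 1 else 2 ^ r + 1) ∧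
      IsRightCosetReps (unitGroup O') (unitGroup O)
        ({e₃} ∪ {x | ∃ a ∈ S, residue R a ^ 2 + residue R a + 1 ≠ 0 ∧ x = 1 + a • e₃}) := by
  have := charP_residueField hR
  rw [← card_option_not_primitive_cube_root hr]
  exact h.cosets_option hR hQ (one_mem_hyperplane _ _ _) hO' hS
    (P := fun a => a ^ 2 + a + 1 ≠ 0) coords_e₃ coords_one_add_smul_e₃
    (τ := fun a => ![1, 0, 0, a]) (by simp [TernaryCoeffs.norm])
    (by simp [TernaryCoeffs.norm]; grind) existsUnique_quadratic_e₃

theorem cosets_klein_e₂ (hR : maximalIdeal R = Ideal.span {2})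
    (h : IsCliffordBasis Q O e₁ e₂ e₃) (hr : Nat.card (ResidueField R) = 2 ^ r)
    (hQ : Q.map (residue R) = ⟨1, 1, 1, 0⟩)
    (hO' : ∀ p, ofCoords R e₁ e₂ e₃ p ∈ O' ↔ red p ∈ hyperplane 1 1 0)
    (hS : Set.BijOn (residue R) S Set.univ) :
    (unitGroup O').relIndex (unitGroup O) = 2 ^ r ∧
      IsRightCosetReps (unitGroup O') (unitGroup O)
        ({e₂} ∪ {x | ∃ a ∈ S, residue R a ≠ 1 ∧ x = 1 + a • e₂}) := by
  have := charP_residueField hR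
  rw [← hr, ← card_option_ne (1 : ResidueField R)]
  exact h.cosets_option hR hQ (one_mem_hyperplane _ _ _) hO' hS (P := fun a => a ≠ 1)
    coords_e₂ coords_one_add_smul_e₂ (τ := fun a => ![1, 0, a, 0])
    (by simp [TernaryCoeffs.norm]) (by simp [TernaryCoeffs.norm]; grind) existsUnique_klein_e₂

theorem cosets_cyclic_e₃ (hR : maximalIdeal R = Ideal.span {2})
    (h : IsCliffordBasis Q O e₁ e₂ e₃) (hr : Nat.card (ResidueField R) = 2 ^ r)
    (hQ : Q.map (residue R) = ⟨1, 1, 0, 0⟩)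
    (hO' : ∀ p, ofCoords R e₁ e₂ e₃ p ∈ O' ↔ red p ∈ hyperplane 0 0 1)
    (hS : Set.BijOn (residue R) S Set.univ) :
    (unitGroup O').relIndex (unitGroup O) = 2 ^ r ∧
      IsRightCosetReps (unitGroup O') (unitGroup O)
        ({e₃} ∪ {x | ∃ a ∈ S, residue R a ≠ 1 ∧ x = 1 + a • e₃}) := by
  have := charP_residueField hR
  rw [← hr, ← card_option_ne (1 : ResidueField R)]
  exact h.cosets_option hR hQ (one_mem_hyperplane _ _ _) hO' hS (P := fun a => a ≠ 1)
    coords_e₃ coords_one_add_smul_e₃ (τ := fun a => ![1, 0, 0, a])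
    (by simp [TernaryCoeffs.norm]) (by simp [TernaryCoeffs.norm]; grind) existsUnique_cyclic_e₃

theorem cosets_cyclic_shift (hR : maximalIdeal R = Ideal.span {2})
    (h : IsCliffordBasis Q O e₁ e₂ e₃) (hr : Nat.card (ResidueField R) = 2 ^ r)
    (hQ : Q.map (residue R) = ⟨1, 1, 0, 0⟩)
    (hO' : ∀ p, ofCoords R e₁ e₂ e₃ p ∈ O' ↔ red p ∈ hyperplane 1 1 0)
    (hS : Set.BijOn (residue R) S Set.univ) :
    (unitGroup O').relIndex (unitGroup O) = 2 ^ r ∧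
      IsRightCosetReps (unitGroup O') (unitGroup O) (Descent.shiftReps S e₂) := by
  have := charP_residueField hR
  rw [← hr, ← card_option_ne (0 : ResidueField R)]
  exact h.cosets_option hR hQ (one_mem_hyperplane _ _ _) hO' hS (P := fun a => a ≠ 0)
    coords_one coords_smul_one_add_e₂ (τ := fun a => ![a, 0, 1, 0])
    (by simp [TernaryCoeffs.norm]) (by simp [TernaryCoeffs.norm]) existsUnique_cyclic_shift

theorem cosets_nilpotent_shift_e₂ (hR : maximalIdeal R = Ideal.span {2})
    (h : IsCliffordBasis Q O e₁ e₂ e₃) (hr : Nat.card (ResidueField R) = 2 ^ r)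
    (hQ : Q.map (residue R) = ⟨1, 0, 0, 0⟩) {v : ResidueField R}
    (hO' : ∀ p, ofCoords R e₁ e₂ e₃ p ∈ O' ↔ red p ∈ hyperplane 0 1 v)
    (hS : Set.BijOn (residue R) S Set.univ) :
    (unitGroup O').relIndex (unitGroup O) = 2 ^ r ∧
      IsRightCosetReps (unitGroup O') (unitGroup O) (Descent.shiftReps S e₂) := by
  have := charP_residueField hR
  rw [← hr, ← card_option_ne (0 : ResidueField R)]
  exact h.cosets_option hR hQ (one_mem_hyperplane _ _ _) hO' hS (P := fun a => a ≠ 0)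
    coords_one coords_smul_one_add_e₂ (τ := fun a => ![a, 0, 1, 0])
    (by simp [TernaryCoeffs.norm]) (by simp [TernaryCoeffs.norm])
    fun x => existsUnique_nilpotent_shift_e₂ x v

theorem cosets_nilpotent_shift_e₃ (hR : maximalIdeal R = Ideal.span {2})
    (h : IsCliffordBasis Q O e₁ e₂ e₃) (hr : Nat.card (ResidueField R) = 2 ^ r)
    (hQ : Q.map (residue R) = ⟨1, 0, 0, 0⟩)
    (hO' : ∀ p, ofCoords R e₁ e₂ e₃ p ∈ O' ↔ red p ∈ hyperplane 0 1 1)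
    (hS : Set.BijOn (residue R) S Set.univ) :
    (unitGroup O').relIndex (unitGroup O) = 2 ^ r ∧
      IsRightCosetReps (unitGroup O') (unitGroup O) (Descent.shiftReps S e₃) := by
  have := charP_residueField hR
  rw [← hr, ← card_option_ne (0 : ResidueField R)]
  exact h.cosets_option hR hQ (one_mem_hyperplane _ _ _) hO' hS (P := fun a => a ≠ 0)
    coords_one coords_smul_one_add_e₃ (τ := fun a => ![a, 0, 0, 1])
    (by simp [TernaryCoeffs.norm]) (by simp [TernaryCoeffs.norm]) existsUnique_nilpotent_shift_e₃

theorem cosets_matrix_field (hR : maximalIdeal R = Ideal.span {2})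
    (h : IsCliffordBasis Q O e₁ e₂ e₃) (hr : Nat.card (ResidueField R) = 2 ^ r)
    (hodd : ¬ Even r) (hQ : Q.map (residue R) = ⟨0, 0, 1, 1⟩)
    (hO' : ∀ p, ofCoords R e₁ e₂ e₃ p ∈ O' ↔ red p ∈ hyperplane 1 1 0 ⊓ hyperplane 0 1 1)
    (hS : Set.BijOn (residue R) S Set.univ) :
    (unitGroup O').relIndex (unitGroup O) = 2 ^ r * (2 ^ r - 1) ∧
      IsRightCosetReps (unitGroup O') (unitGroup O)
        {x | ∃ a ∈ S, ∃ b ∈ S, residue R b ≠ 0 ∧ x = (1 + a • e₂) * (e₁ + b • e₂)} := by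
  have := charP_residueField hR
  obtain ⟨σ, hσS, hσ, hSσ⟩ := exists_residue_section hS
  have hrange :
      {x | ∃ a ∈ S, ∃ b ∈ S, residue R b ≠ 0 ∧ x = (1 + a • e₂) * (e₁ + b • e₂)} =
      Set.range (fun i : ResidueField R × {b : ResidueField R // b ≠ 0} =>
        (1 + σ i.1 • e₂) * (e₁ + σ i.2 • e₂)) := by
    ext x
    constructor
    · rintro ⟨a, ha, b, hb, hb0, rfl⟩
      exact ⟨(residue R a, ⟨residue R b, hb0⟩), by simp only [hSσ a ha, hSσ b hb]⟩
    · rintro ⟨⟨a, b, hb⟩, rfl⟩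
      exact ⟨_, hσS _, _, hσS _, by rwa [hσ], rfl⟩
  rw [hrange, ← hr, ← card_subtype_ne (0 : ResidueField R), ← Nat.card_prod]
  refine h.relIndex_and_isRightCosetReps hR (Submodule.mem_inf.mpr
    ⟨one_mem_hyperplane _ _ _, one_mem_hyperplane _ _ _⟩) hO'
    (τ := fun i => ![0, 1, i.2, i.1]) (fun i => ?_) ?_ ?_
  · obtain ⟨p, hp, hp'⟩ := h.exists_coords hQ (coords_one_add_smul_e₂ (σ i.1))
      (coords_e₁_add_smul_e₂ (σ i.2))
    refine ⟨p, hp, hp'.trans ?_⟩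
    ext j
    fin_cases j <;> simp [TernaryCoeffs.mul, hσ]
  · rintro ⟨a, b, hb⟩
    simpa [hQ, TernaryCoeffs.norm] using hb
  · rw [hQ]
    exact fun x => existsUnique_matrix_field x
      fun b hb => hodd ((exists_primitive_cube_root_iff hr).mp ⟨b, hb⟩)

theorem cosets_matrix_split (hR : maximalIdeal R = Ideal.span {2})
    (h : IsCliffordBasis Q O e₁ e₂ e₃) (hr : Nat.card (ResidueField R) = 2 ^ r)
    (heven : Even r) (hQ : Q.map (residue R) = ⟨0, 0, 1, 1⟩)
    (hO' : ∀ p, ofCoords R e₁ e₂ e₃ p ∈ O' ↔ red p ∈ hyperplane 1 1 0 ⊓ hyperplane 0 1 1)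
    (hS : Set.BijOn (residue R) S Set.univ) :
    (unitGroup O').relIndex (unitGroup O) = 2 ^ r * (2 ^ r + 1) ∧
      IsRightCosetReps (unitGroup O') (unitGroup O)
        ({x | ∃ a ∈ S, ∃ b ∈ S, residue R b ≠ 0 ∧ x = (e₁ + b • e₂) * (1 + a • e₂)} ∪
          {x | ∃ a ∈ S, ∃ b ∈ S, residue R b ^ 2 + residue R b + 1 = 0 ∧
            x = (b • (1 : B) + e₁) * (1 + a • e₂)}) := by
  have := charP_residueField hR
  obtain ⟨σ, hσS, hσ, hSσ⟩ := exists_residue_section hS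
  have hrange :
      {x | ∃ a ∈ S, ∃ b ∈ S, residue R b ≠ 0 ∧ x = (e₁ + b • e₂) * (1 + a • e₂)} ∪
        {x | ∃ a ∈ S, ∃ b ∈ S, residue R b ^ 2 + residue R b + 1 = 0 ∧
          x = (b • (1 : B) + e₁) * (1 + a • e₂)} =
      Set.range (fun i : ResidueField R × {b : ResidueField R // b ≠ 0} ⊕
          ResidueField R × {b : ResidueField R // b ^ 2 + b + 1 = 0} =>
        i.elim (fun i => (e₁ + σ i.2 • e₂) * (1 + σ i.1 • e₂))
          fun i => (σ i.2 • (1 : B) + e₁) * (1 + σ i.1 • e₂)) := by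
    ext x
    constructor
    · rintro (⟨a, ha, b, hb, hb0, rfl⟩ | ⟨a, ha, b, hb, hb0, rfl⟩)
      · exact ⟨.inl (residue R a, ⟨residue R b, hb0⟩), by
          simp only [Sum.elim_inl, hSσ a ha, hSσ b hb]⟩
      · exact ⟨.inr (residue R a, ⟨residue R b, hb0⟩), by
          simp only [Sum.elim_inr, hSσ a ha, hSσ b hb]⟩
    · rintro ⟨⟨a, b, hb⟩ | ⟨a, b, hb⟩, rfl⟩
      · exact .inl ⟨_, hσS _, _, hσS _, by rwa [hσ], rfl⟩
      · exact .inr ⟨_, hσS _, _, hσS _, by rwa [hσ], rfl⟩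
  -- The two families contribute `q (q - 1)` and `2 q` elements.
  have hcard : 2 ^ r * (2 ^ r + 1) = Nat.card (ResidueField R × {b : ResidueField R // b ≠ 0} ⊕
      ResidueField R × {b : ResidueField R // b ^ 2 + b + 1 = 0}) := by
    rw [Nat.card_sum, Nat.card_prod, Nat.card_prod, card_subtype_ne,
      card_primitive_cube_roots_of_even hr heven, hr, ← mul_add]
    congr 1
    have : 0 < 2 ^ r := by positivity
    omega
  rw [hrange, hcard]
  refine h.relIndex_and_isRightCosetReps hR (Submodule.mem_inf.mpr
    ⟨one_mem_hyperplane _ _ _, one_mem_hyperplane _ _ _⟩) hO'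
    (τ := fun i => i.elim (fun i => ![i.1, 1, i.2, -i.1])
          fun i => ![i.1 + i.2, 1, i.1 * i.2, -i.1]) ?_ ?_ ?_
  · rintro (⟨a, b, hb⟩ | ⟨a, b, hb⟩)
    · obtain ⟨p, hp, hp'⟩ := h.exists_coords hQ (coords_e₁_add_smul_e₂ (σ b))
        (coords_one_add_smul_e₂ (σ a))
      refine ⟨p, hp, hp'.trans ?_⟩
      ext j
      fin_cases j <;> simp [TernaryCoeffs.mul, hσ]
    · obtain ⟨p, hp, hp'⟩ := h.exists_coords hQ (coords_smul_one_add_e₁ (σ b))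
        (coords_one_add_smul_e₂ (σ a))
      refine ⟨p, hp, hp'.trans ?_⟩
      ext j
      fin_cases j <;> simp [TernaryCoeffs.mul, hσ] <;> ring
  · rintro (⟨a, b, hb⟩ | ⟨a, b, hb⟩) <;> simp [hQ, TernaryCoeffs.norm] <;> grind
  · rw [hQ]
    exact existsUnique_matrix_split

end IsCliffordBasis

end Cosets

/-! ### The prime 2 generates the maximal ideal of the completion. -/

open IsDedekindDomain in
theorem maximalIdeal_adicCompletionIntegers_eq_span_two {K : Type*} [Field K] [NumberField K]
    (v : HeightOneSpectrum (NumberField.RingOfIntegers K))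
    (hv : v.asIdeal = Ideal.span {(2 : NumberField.RingOfIntegers K)}) :
    maximalIdeal (v.adicCompletionIntegers K) = Ideal.span {2} := by
  have h2 : Valued.v (2 : v.adicCompletion K) = WithZero.exp (-1 : ℤ) := by
    have h := v.valuedAdicCompletion_eq_valuation (K := K) 2
    rw [v.valuation_of_algebraMap, v.intValuation_singleton two_ne_zero hv] at h
    rw [← h, ← map_ofNat (algebraMap (NumberField.RingOfIntegers K) (v.adicCompletion K)) 2]
    rfl
  have h20 : (2 : v.adicCompletion K) ≠ 0 := by
    intro h
    rw [h, map_zero] at h2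
    exact WithZero.exp_ne_zero h2.symm
  ext x
  have hlt : x ∈ maximalIdeal (v.adicCompletionIntegers K) ↔
      Valued.v (x : v.adicCompletion K) < 1 :=
    (ValuationSubring.valuation_lt_one_iff _ x).trans
      (Valuation.isEquiv_valuation_valuationSubring
        (Valued.v : Valuation (v.adicCompletion K) _)).lt_one_iff_lt_one.symm
  rw [Ideal.mem_span_singleton, hlt]
  constructor
  · intro hx
    have hle : Valued.v (x / 2 : v.adicCompletion K) ≤ 1 := by
      rw [map_div₀, h2, div_le_one₀ WithZero.exp_pos]
      by_cases h0 : Valued.v (x : v.adicCompletion K) = 0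
      · rw [h0]; exact zero_le
      -- The value group is discrete: a valuation below 1 is at most `exp (-1)`, the valuation of 2.
      · rw [← WithZero.exp_zero, ← WithZero.log_lt_iff_lt_exp h0] at hx
        rw [← WithZero.log_le_iff_le_exp h0]
        omega
    exact ⟨⟨_, hle⟩, Subtype.ext (mul_div_cancel₀ (x : v.adicCompletion K) h20).symm⟩
  · rintro ⟨y, rfl⟩
    have hy : Valued.v (y : v.adicCompletion K) ≤ 1 := y.2
    have h : Valued.v (2 * (y : v.adicCompletion K)) < 1 := by
      rw [map_mul, h2]
      refine mul_lt_one_of_lt_of_le ?_ hy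
      rw [← WithZero.exp_zero, WithZero.exp_lt_exp]
      norm_num
    exact h


/-! ### Images of the suborders modulo 2, as spans of the reduced generators. -/

section SuborderImages

variable {k : Type*} [Field k] [CharP k 2]

theorem hyperplane_eq_span_e₁_zero_e₃ : hyperplane (0 : k) 1 0 =
    Submodule.span k {TernaryCoeffs.one, ![0, 1, 0, 0], ![0, 0, 0, 0], ![0, 0, 0, 1]} := by
  ext y
  rw [mem_span_four]
  simp only [mem_hyperplane]
  constructor
  · intro h
    refine ⟨y 0, y 1, 0, y 3, funext fun i => ?_⟩
    fin_cases i <;> simp [TernaryCoeffs.one]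
    grind
  · rintro ⟨a, b, c, d, rfl⟩
    simp [TernaryCoeffs.one]

theorem hyperplane_eq_span_zero_e₁_e₃ : hyperplane (0 : k) 1 0 =
    Submodule.span k {TernaryCoeffs.one, ![0, 0, 0, 0], ![0, 1, 0, 0], ![0, 0, 0, 1]} := by
  ext y
  rw [mem_span_four]
  simp only [mem_hyperplane]
  constructor
  · intro h
    refine ⟨y 0, 0, y 1, y 3, funext fun i => ?_⟩
    fin_cases i <;> simp [TernaryCoeffs.one]
    grind
  · rintro ⟨a, b, c, d, rfl⟩
    simp [TernaryCoeffs.one]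

theorem hyperplane_inf_eq_span_zero_zero_diag : hyperplane (1 : k) 1 0 ⊓ hyperplane (0 : k) 1 1 =
    Submodule.span k {TernaryCoeffs.one, ![0, 0, 0, 0], ![0, 0, 0, 0], ![0, 1, 1, 1]} := by
  ext y
  rw [mem_span_four]
  simp only [Submodule.mem_inf, mem_hyperplane]
  constructor
  · intro h
    refine ⟨y 0, 0, 0, y 3, funext fun i => ?_⟩
    fin_cases i <;> simp [TernaryCoeffs.one] <;> grind
  · rintro ⟨a, b, c, d, rfl⟩
    simp [TernaryCoeffs.one]
    grind

theorem hyperplane_inf_eq_span_zero_zero_e₃ : hyperplane (1 : k) 0 0 ⊓ hyperplane (0 : k) 1 0 =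
    Submodule.span k {TernaryCoeffs.one, ![0, 0, 0, 0], ![0, 0, 0, 0], ![0, 0, 0, 1]} := by
  ext y
  rw [mem_span_four]
  simp only [Submodule.mem_inf, mem_hyperplane]
  constructor
  · intro h
    refine ⟨y 0, 0, 0, y 3, funext fun i => ?_⟩
    fin_cases i <;> simp [TernaryCoeffs.one] <;> grind
  · rintro ⟨a, b, c, d, rfl⟩
    simp [TernaryCoeffs.one]

theorem hyperplane_eq_span_zero_e₂_e₁ : hyperplane (0 : k) 0 1 =
    Submodule.span k {TernaryCoeffs.one, ![0, 0, 0, 0], ![0, 0, 1, 0], ![0, 1, 0, 0]} := by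
  ext y
  rw [mem_span_four]
  simp only [mem_hyperplane]
  constructor
  · intro h
    refine ⟨y 0, 0, y 2, y 1, funext fun i => ?_⟩
    fin_cases i <;> simp [TernaryCoeffs.one]
    grind
  · rintro ⟨a, b, c, d, rfl⟩
    simp [TernaryCoeffs.one]

theorem hyperplane_eq_span_sum_sum_e₃ : hyperplane (1 : k) 1 0 =
    Submodule.span k {TernaryCoeffs.one, ![0, 1, 1, 0], ![0, 1, 1, 0], ![0, 0, 0, 1]} := by
  ext y
  rw [mem_span_four]
  simp only [mem_hyperplane]
  constructor
  · intro h
    refine ⟨y 0, y 1, 0, y 3, funext fun i => ?_⟩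
    fin_cases i <;> simp [TernaryCoeffs.one]
    grind
  · rintro ⟨a, b, c, d, rfl⟩
    simp [TernaryCoeffs.one]
    grind

theorem hyperplane_eq_span_sum_sum_sum : hyperplane (1 : k) 1 1 =
    Submodule.span k {TernaryCoeffs.one, ![0, 1, 1, 0], ![0, 1, 1, 0], ![0, 1, 0, 1]} := by
  ext y
  rw [mem_span_four]
  simp only [mem_hyperplane]
  constructor
  · intro h
    refine ⟨y 0, y 2, 0, y 3, funext fun i => ?_⟩
    fin_cases i <;> simp [TernaryCoeffs.one]
    grind
  · rintro ⟨a, b, c, d, rfl⟩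
    simp [TernaryCoeffs.one]
    grind

theorem hyperplane_eq_span_zero_e₁_diag : hyperplane (0 : k) 1 1 =
    Submodule.span k {TernaryCoeffs.one, ![0, 0, 0, 0], ![0, 1, 0, 0], ![0, 1, 1, 1]} := by
  ext y
  rw [mem_span_four]
  simp only [mem_hyperplane]
  constructor
  · intro h
    refine ⟨y 0, 0, y 1 - y 3, y 3, funext fun i => ?_⟩
    fin_cases i <;> simp [TernaryCoeffs.one]
    grind
  · rintro ⟨a, b, c, d, rfl⟩
    simp [TernaryCoeffs.one]
    grind

theorem hyperplane_eq_span_zero_e₁_sum : hyperplane (0 : k) 1 1 =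
    Submodule.span k {TernaryCoeffs.one, ![0, 0, 0, 0], ![0, 1, 0, 0], ![0, 0, 1, 1]} := by
  ext y
  rw [mem_span_four]
  simp only [mem_hyperplane]
  constructor
  · intro h
    refine ⟨y 0, 0, y 1, y 3, funext fun i => ?_⟩
    fin_cases i <;> simp [TernaryCoeffs.one]
    grind
  · rintro ⟨a, b, c, d, rfl⟩
    simp [TernaryCoeffs.one]
    grind

/-- These are the reduced generators of both A1→B and A2→B, whose `dᵢ` have odd constant terms. -/
theorem hyperplane_eq_span_shifted : hyperplane (0 : k) 0 1 =
    Submodule.span k {TernaryCoeffs.one, ![1, 1, 0, 0], ![1, 0, 1, 0], ![1, 1, 1, 0]} := by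
  ext y
  rw [mem_span_four]
  simp only [mem_hyperplane]
  constructor
  · intro h
    refine ⟨y 0 - y 1 - y 2, y 1, y 2, 0, funext fun i => ?_⟩
    fin_cases i <;> simp [TernaryCoeffs.one] <;> grind
  · rintro ⟨a, b, c, d, rfl⟩
    simp [TernaryCoeffs.one]

end SuborderImages

/-! ### The subspace attached to each descent. -/

section Descents

theorem ofNat_mul_eq_smul {R B : Type*} [CommRing R] [Ring B] [Algebra R B] (n : ℕ)
    [n.AtLeastTwo] (x : B) : (ofNat(n) : B) * x = (ofNat(n) : R) • x := by
  rw [ofNat_smul_eq_nsmul, nsmul_eq_mul, Nat.cast_ofNat]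

theorem ofNat_eq_smul_one {R B : Type*} [CommRing R] [Ring B] [Algebra R B] (n : ℕ)
    [n.AtLeastTwo] : (ofNat(n) : B) = (ofNat(n) : R) • (1 : B) := by
  rw [← ofNat_mul_eq_smul, mul_one]

variable {R : Type*} [CommRing R] [IsLocalRing R] {B : Type*} [Ring B] [Algebra R B]
  {O O' : Subalgebra R B} {e₁ e₂ e₃ : B} {S : Set R} {r : ℕ} {μ : SquareRoots R}

/-- In characteristic 2 the equation becomes `(x - 1)² = 0`. It shows that the `μᵢ` used below
reduce to 1. -/
theorem residue_eq_one_of_mul_sq (hR : maximalIdeal R = Ideal.span {2}) {x : R} (a b : R)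
    (h : (2 * a + 1) * x ^ 2 = 2 * b + 1) : residue R x = 1 := by
  have := charP_residueField hR
  have h' := congrArg (residue R) h
  simp only [map_mul, map_add, map_pow, residue_two hR, map_one, zero_mul, zero_add, one_mul] at h'
  have : (residue R x - 1) ^ 2 = 0 := by grind
  simpa [sub_eq_zero] using this

theorem Descent.mem_iff (hR : maximalIdeal R = Ideal.span {2}) (h : IsOrderBasis O e₁ e₂ e₃)
    {f g : BassForm} (D : Descent f g) (hO' : Subalgebra.toSubmodule O' = D.lattice μ e₁ e₂ e₃)
    (x y z : Fin 4 → R) {x' y' z' : Fin 4 → ResidueField R}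
    (hgens : D.gens μ e₁ e₂ e₃ = (x 0 • (1 : B) + x 1 • e₁ + x 2 • e₂ + x 3 • e₃,
      y 0 • (1 : B) + y 1 • e₁ + y 2 • e₂ + y 3 • e₃,
      z 0 • (1 : B) + z 1 • e₁ + z 2 • e₂ + z 3 • e₃))
    (hred : ∀ i, residue R (x i) = x' i ∧ residue R (y i) = y' i ∧ residue R (z i) = z' i)
    {L : Submodule (ResidueField R) (Fin 4 → ResidueField R)}
    (hL : L = Submodule.span (ResidueField R) {TernaryCoeffs.one, x', y', z'})
    (h2 : ∀ p : Fin 4 → R, (2 : R) • p ∈ Submodule.span R {TernaryCoeffs.one, x, y, z})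
    (p : Fin 4 → R) : ofCoords R e₁ e₂ e₃ p ∈ O' ↔ red p ∈ L := by
  obtain rfl : red x = x' := funext fun i => (hred i).1
  obtain rfl : red y = y' := funext fun i => (hred i).2.1
  obtain rfl : red z = z' := funext fun i => (hred i).2.2
  refine h.mem_suborder_iff hR hL h2 ?_ p
  rw [hO', Descent.lattice, hgens]
  simp only [ofCoords_apply]

theorem Descent.A1A2_mem_iff (hR : maximalIdeal R = Ideal.span {2})
    (h : IsOrderBasis O e₁ e₂ e₃)
    (hO' : Subalgebra.toSubmodule O' = Descent.lattice μ e₁ e₂ e₃ Descent.A1A2)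
    (p : Fin 4 → R) :
    ofCoords R e₁ e₂ e₃ p ∈ O' ↔ red p ∈ hyperplane 1 1 0 ⊓ hyperplane 0 1 1 := by
  have := charP_residueField hR
  have h1 : residue R μ.μ₁ = 1 :=
    residue_eq_one_of_mul_sq hR 0 (-4) (by linear_combination μ.eq₁)
  exact Descent.mem_iff hR h _ hO'
    ((2 : R) • ![μ.μ₁, -2, -3, -2 * μ.μ₁])
    ((2 : R) • ![-μ.μ₁, 3, 2, 2 * μ.μ₁]) ![-2, -μ.μ₁, -μ.μ₁, 5]
    (by
      simp only [Descent.gens, ofNat_eq_smul_one (R := R) (B := B), smul_mul_assoc, one_mul]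
      refine Prod.ext ?_ (Prod.ext ?_ ?_) <;> simp <;> module)
    (fun i => by
      fin_cases i <;> simp [-IsLocalRing.residue_eq_zero_iff, map_ofNat (residue R), h1] <;> grind)
    hyperplane_inf_eq_span_zero_zero_diag
    (two_smul_mem_span_of_det_unit (v := -3)
      (by simp only [map_neg, map_ofNat]; grind)
      (by simp only [det3, Matrix.cons_val]; linear_combination 4 * μ.eq₁)) p

theorem Descent.A1A1_mem_iff (hR : maximalIdeal R = Ideal.span {2})
    (h : IsOrderBasis O e₁ e₂ e₃) {s : ℕ}
    (hO' : Subalgebra.toSubmodule O' = Descent.lattice μ e₁ e₂ e₃ (Descent.A1A1 s))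
    (p : Fin 4 → R) :
    ofCoords R e₁ e₂ e₃ p ∈ O' ↔ red p ∈ hyperplane 0 1 0 := by
  have := charP_residueField hR
  exact Descent.mem_iff hR h _ hO'
    ![0, 1, 0, 0] ![0, 0, 2, 0] ![0, 0, 0, 1]
    (by
      simp only [Descent.gens, ofNat_mul_eq_smul (R := R) (B := B)]
      refine Prod.ext ?_ (Prod.ext ?_ ?_) <;> simp)
    (fun i => by
      fin_cases i <;> simp [-IsLocalRing.residue_eq_zero_iff, map_ofNat (residue R)]
      grind)
    hyperplane_eq_span_e₁_zero_e₃
    (two_smul_mem_span_of_det (n := 1) (v := 1)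
      (by simp)
      (by simp only [det3, Matrix.cons_val]; ring)) p

theorem Descent.A1B_mem_iff (hR : maximalIdeal R = Ideal.span {2})
    (h : IsOrderBasis O e₁ e₂ e₃)
    (hO' : Subalgebra.toSubmodule O' = Descent.lattice μ e₁ e₂ e₃ Descent.A1B)
    (p : Fin 4 → R) :
    ofCoords R e₁ e₂ e₃ p ∈ O' ↔ red p ∈ hyperplane 0 0 1 := by
  have := charP_residueField hR
  have h1 : residue R μ.μ₁ = 1 :=
    residue_eq_one_of_mul_sq hR 0 (-4) (by linear_combination μ.eq₁)
  exact Descent.mem_iff hR h _ hO'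
    ![μ.μ₁, 1, 2, -2 * μ.μ₁]
    ![-5, 2 * μ.μ₁, μ.μ₁, 10] ![μ.μ₁, 3, 1, -2 * μ.μ₁]
    (by
      simp only [Descent.gens, ofNat_eq_smul_one (R := R) (B := B), smul_mul_assoc, one_mul]
      refine Prod.ext ?_ (Prod.ext ?_ ?_) <;> simp <;> module)
    (fun i => by
      fin_cases i <;> simp [-IsLocalRing.residue_eq_zero_iff, map_ofNat (residue R), h1] <;> grind)
    hyperplane_eq_span_shifted
    (two_smul_mem_span_of_det (n := 1) (v := -3)
      (by simp only [map_neg, map_ofNat]; grind)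
      (by simp only [det3, Matrix.cons_val]; linear_combination 8 * μ.eq₁)) p

theorem Descent.A2A2_mem_iff (hR : maximalIdeal R = Ideal.span {2})
    (h : IsOrderBasis O e₁ e₂ e₃) {s : ℕ} (hs : 1 ≤ s)
    (hO' : Subalgebra.toSubmodule O' = Descent.lattice μ e₁ e₂ e₃ (Descent.A2A2 s hs))
    (p : Fin 4 → R) :
    ofCoords R e₁ e₂ e₃ p ∈ O' ↔ red p ∈ hyperplane 1 0 0 ⊓ hyperplane 0 1 0 := by
  have := charP_residueField hR
  exact Descent.mem_iff hR h _ hO'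
    ((2 : R) • ![0, 1, 0, 0]) ((2 : R) • ![0, 0, 1, 0]) ![0, 0, 0, 1]
    (by
      simp only [Descent.gens, ofNat_mul_eq_smul (R := R) (B := B)]
      refine Prod.ext ?_ (Prod.ext ?_ ?_) <;> simp)
    (fun i => by
      fin_cases i <;> simp [-IsLocalRing.residue_eq_zero_iff, map_ofNat (residue R)] <;> grind)
    hyperplane_inf_eq_span_zero_zero_e₃
    (two_smul_mem_span_of_det_unit (v := 1)
      (by simp)
      (by simp only [det3, Matrix.cons_val]; ring)) p

theorem Descent.A2B_mem_iff (hR : maximalIdeal R = Ideal.span {2})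
    (h : IsOrderBasis O e₁ e₂ e₃)
    (hO' : Subalgebra.toSubmodule O' = Descent.lattice μ e₁ e₂ e₃ Descent.A2B)
    (p : Fin 4 → R) :
    ofCoords R e₁ e₂ e₃ p ∈ O' ↔ red p ∈ hyperplane 0 0 1 := by
  have := charP_residueField hR
  have h2 : residue R μ.μ₂ = 1 :=
    residue_eq_one_of_mul_sq hR 1 (-7) (by linear_combination μ.eq₂)
  exact Descent.mem_iff hR h _ hO'
    ![μ.μ₂, -1, 2, -2 * μ.μ₂]
    ![μ.μ₂, -2, 1, -2 * μ.μ₂] ![-3, -μ.μ₂, μ.μ₂, 6]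
    (by
      simp only [Descent.gens, ofNat_eq_smul_one (R := R) (B := B), smul_mul_assoc, one_mul]
      refine Prod.ext ?_ (Prod.ext ?_ ?_) <;> simp <;> module)
    (fun i => by
      fin_cases i <;> simp [-IsLocalRing.residue_eq_zero_iff, map_ofNat (residue R), h2] <;> grind)
    hyperplane_eq_span_shifted
    (two_smul_mem_span_of_det (n := 3) (v := 1)
      (by simp)
      (by simp only [det3, Matrix.cons_val]; linear_combination 4 * μ.eq₂)) p

theorem Descent.BB_mem_iff (hR : maximalIdeal R = Ideal.span {2})
    (h : IsOrderBasis O e₁ e₂ e₃) {δ s : ℕ} (hδ : δ = 1 ∨ δ = 3)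
    (hO' : Subalgebra.toSubmodule O' = Descent.lattice μ e₁ e₂ e₃ (Descent.BB δ s hδ))
    (p : Fin 4 → R) :
    ofCoords R e₁ e₂ e₃ p ∈ O' ↔ red p ∈ hyperplane 1 1 0 := by
  have := charP_residueField hR
  exact Descent.mem_iff hR h _ hO'
    ![0, 1, -1, 0] ![0, 1, 1, 0] ![0, 0, 0, 1]
    (by
      simp only [Descent.gens]
      refine Prod.ext ?_ (Prod.ext ?_ ?_) <;> simp
      module)
    (fun i => by
      fin_cases i <;> simp [-IsLocalRing.residue_eq_zero_iff]
      grind)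
    hyperplane_eq_span_sum_sum_e₃
    (two_smul_mem_span_of_det (n := 1) (v := 1)
      (by simp)
      (by simp only [det3, Matrix.cons_val]; ring)) p

theorem Descent.BC₁_mem_iff (hR : maximalIdeal R = Ideal.span {2})
    (h : IsOrderBasis O e₁ e₂ e₃)
    (hO' : Subalgebra.toSubmodule O' = Descent.lattice μ e₁ e₂ e₃ Descent.BC₁)
    (p : Fin 4 → R) :
    ofCoords R e₁ e₂ e₃ p ∈ O' ↔ red p ∈ hyperplane 0 0 1 := by
  have := charP_residueField hR
  exact Descent.mem_iff hR h _ hO'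
    ![0, 2, 0, 2] ![0, 0, 1, 0] ![0, -1, 0, 2]
    (by
      simp only [Descent.gens, ofNat_mul_eq_smul (R := R) (B := B)]
      refine Prod.ext ?_ (Prod.ext ?_ ?_) <;> simp
      module)
    (fun i => by
      fin_cases i <;> simp [-IsLocalRing.residue_eq_zero_iff, map_ofNat (residue R)] <;> grind)
    hyperplane_eq_span_zero_e₂_e₁
    (two_smul_mem_span_of_det (n := 1) (v := 3)
      (by simp only [map_ofNat]; grind)
      (by simp only [det3, Matrix.cons_val]; ring)) p

theorem Descent.BC₃_mem_iff (hR : maximalIdeal R = Ideal.span {2})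
    (h : IsOrderBasis O e₁ e₂ e₃)
    (hO' : Subalgebra.toSubmodule O' = Descent.lattice μ e₁ e₂ e₃ Descent.BC₃)
    (p : Fin 4 → R) :
    ofCoords R e₁ e₂ e₃ p ∈ O' ↔ red p ∈ hyperplane 0 0 1 := by
  have := charP_residueField hR
  exact Descent.mem_iff hR h _ hO'
    ![0, 0, 0, 6] ![0, 0, 1, 0] ![0, -1, 0, 0]
    (by
      simp only [Descent.gens, ofNat_mul_eq_smul (R := R) (B := B)]
      refine Prod.ext ?_ (Prod.ext ?_ ?_) <;> simp)
    (fun i => by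
      fin_cases i <;> simp [-IsLocalRing.residue_eq_zero_iff, map_ofNat (residue R)] <;> grind)
    hyperplane_eq_span_zero_e₂_e₁
    (two_smul_mem_span_of_det (n := 1) (v := 3)
      (by simp only [map_ofNat]; grind)
      (by simp only [det3, Matrix.cons_val]; ring)) p

theorem Descent.BD₁_mem_iff (hR : maximalIdeal R = Ideal.span {2})
    (h : IsOrderBasis O e₁ e₂ e₃)
    (hO' : Subalgebra.toSubmodule O' = Descent.lattice μ e₁ e₂ e₃ Descent.BD₁)
    (p : Fin 4 → R) :
    ofCoords R e₁ e₂ e₃ p ∈ O' ↔ red p ∈ hyperplane 1 1 1 := by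
  have := charP_residueField hR
  exact Descent.mem_iff hR h _ hO'
    ![0, 1, -5, 4] ![0, 1, 1, 4] ![0, -1, 0, 1]
    (by
      simp only [Descent.gens, ofNat_mul_eq_smul (R := R) (B := B)]
      refine Prod.ext ?_ (Prod.ext ?_ ?_) <;> simp <;> module)
    (fun i => by
      fin_cases i <;> simp [-IsLocalRing.residue_eq_zero_iff, map_ofNat (residue R)] <;> grind)
    hyperplane_eq_span_sum_sum_sum
    (two_smul_mem_span_of_det (n := 1) (v := 15)
      (by simp only [map_ofNat]; grind)
      (by simp only [det3, Matrix.cons_val]; ring)) p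

theorem Descent.BD₃_mem_iff (hR : maximalIdeal R = Ideal.span {2})
    (h : IsOrderBasis O e₁ e₂ e₃)
    (hO' : Subalgebra.toSubmodule O' = Descent.lattice μ e₁ e₂ e₃ Descent.BD₃)
    (p : Fin 4 → R) :
    ofCoords R e₁ e₂ e₃ p ∈ O' ↔ red p ∈ hyperplane 1 1 1 := by
  have := charP_residueField hR
  have h1 : residue R μ.μ₁ = 1 :=
    residue_eq_one_of_mul_sq hR 0 (-4) (by linear_combination μ.eq₁)
  have h9 : residue R μ.μ₉ = 1 :=
    residue_eq_one_of_mul_sq hR 7 (-1) (by linear_combination μ.eq₉)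
  exact Descent.mem_iff hR h _ hO'
    ![0, μ.μ₁, -(5 * μ.μ₉), 12]
    ![0, μ.μ₁ * μ.μ₉, 1, 12 * μ.μ₉] ![0, -1, 0, μ.μ₁]
    (by
      simp only [Descent.gens, ofNat_mul_eq_smul (R := R) (B := B)]
      refine Prod.ext ?_ (Prod.ext ?_ ?_) <;> simp <;> module)
    (fun i => by
      fin_cases i <;> simp [-IsLocalRing.residue_eq_zero_iff, map_ofNat (residue R), h1, h9] <;> grind)
    hyperplane_eq_span_sum_sum_sum
    (two_smul_mem_span_of_det (n := 3) (v := 5)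
      (by simp only [map_ofNat]; grind)
      -- The determinant factors as `(μ₁² + 12)(1 + 5 μ₉²)`, that is `5 · (2/3)`, so 3 times it is
      -- `2 · 5`.
      (by simp only [det3, Matrix.cons_val]; linear_combination (μ.μ₁ ^ 2 + 12) * μ.eq₉ + 2 * μ.eq₁)) p

theorem Descent.CC₁_mem_iff (hR : maximalIdeal R = Ideal.span {2})
    (h : IsOrderBasis O e₁ e₂ e₃) {s : ℕ} (hs : 1 ≤ s)
    (hO' : Subalgebra.toSubmodule O' = Descent.lattice μ e₁ e₂ e₃ (Descent.CC₁ s hs))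
    (p : Fin 4 → R) :
    ofCoords R e₁ e₂ e₃ p ∈ O' ↔ red p ∈ hyperplane 0 1 0 := by
  have := charP_residueField hR
  exact Descent.mem_iff hR h _ hO'
    ![0, 0, -6, 0] ![0, 1, 0, 0] ![0, 0, 0, 1]
    (by
      simp only [Descent.gens, ofNat_mul_eq_smul (R := R) (B := B)]
      refine Prod.ext ?_ (Prod.ext ?_ ?_) <;> simp)
    (fun i => by
      fin_cases i <;> simp [-IsLocalRing.residue_eq_zero_iff, map_ofNat (residue R)]
      grind)
    hyperplane_eq_span_zero_e₁_e₃
    (two_smul_mem_span_of_det (n := 1) (v := 3)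
      (by simp only [map_ofNat]; grind)
      (by simp only [det3, Matrix.cons_val]; ring)) p

theorem Descent.CC₃_mem_iff (hR : maximalIdeal R = Ideal.span {2})
    (h : IsOrderBasis O e₁ e₂ e₃) {s : ℕ} (hs : 1 ≤ s)
    (hO' : Subalgebra.toSubmodule O' = Descent.lattice μ e₁ e₂ e₃ (Descent.CC₃ s hs))
    (p : Fin 4 → R) :
    ofCoords R e₁ e₂ e₃ p ∈ O' ↔ red p ∈ hyperplane 0 1 0 := by
  have := charP_residueField hR
  have h4 : residue R μ.μ₄ = 1 :=
    residue_eq_one_of_mul_sq hR 4 0 (by linear_combination μ.eq₄)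
  exact Descent.mem_iff hR h _ hO'
    ![0, 0, -(6 * μ.μ₄), 0] ![0, μ.μ₄, 0, 0] ![0, 0, 0, 1]
    (by
      simp only [Descent.gens]
      refine Prod.ext ?_ (Prod.ext ?_ ?_) <;> simp)
    (fun i => by
      fin_cases i <;> simp [-IsLocalRing.residue_eq_zero_iff, map_ofNat (residue R), h4]
      grind)
    hyperplane_eq_span_zero_e₁_e₃
    (two_smul_mem_span_of_det (n := 9) (v := 3)
      (by simp only [map_ofNat]; grind)
      (by simp only [det3, Matrix.cons_val]; linear_combination 6 * μ.eq₄)) p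

theorem Descent.CE₁_mem_iff (hR : maximalIdeal R = Ideal.span {2})
    (h : IsOrderBasis O e₁ e₂ e₃)
    (hO' : Subalgebra.toSubmodule O' = Descent.lattice μ e₁ e₂ e₃ Descent.CE₁)
    (p : Fin 4 → R) :
    ofCoords R e₁ e₂ e₃ p ∈ O' ↔ red p ∈ hyperplane 0 1 1 := by
  have := charP_residueField hR
  have h7 : residue R μ.μ₇ = 1 :=
    residue_eq_one_of_mul_sq hR 1 (-15) (by linear_combination μ.eq₇)
  exact Descent.mem_iff hR h _ hO'
    ![0, 2 * μ.μ₇, -(2 * (3 * μ.μ₇)), -20] ![0, 1, 2, 0] ![0, 1, -3, μ.μ₇]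
    (by
      simp only [Descent.gens, ofNat_mul_eq_smul (R := R) (B := B)]
      refine Prod.ext ?_ (Prod.ext ?_ ?_) <;> simp <;> module)
    (fun i => by
      fin_cases i <;> simp [-IsLocalRing.residue_eq_zero_iff, map_ofNat (residue R), h7] <;> grind)
    hyperplane_eq_span_zero_e₁_diag
    (two_smul_mem_span_of_det (n := 3) (v := 5)
      (by simp only [map_ofNat]; grind)
      (by simp only [det3, Matrix.cons_val]; linear_combination 10 * μ.eq₇)) p

theorem Descent.CE₃_mem_iff (hR : maximalIdeal R = Ideal.span {2})
    (h : IsOrderBasis O e₁ e₂ e₃)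
    (hO' : Subalgebra.toSubmodule O' = Descent.lattice μ e₁ e₂ e₃ Descent.CE₃)
    (p : Fin 4 → R) :
    ofCoords R e₁ e₂ e₃ p ∈ O' ↔ red p ∈ hyperplane 0 1 1 := by
  have := charP_residueField hR
  have h4 : residue R μ.μ₄ = 1 :=
    residue_eq_one_of_mul_sq hR 4 0 (by linear_combination μ.eq₄)
  have h5 : residue R μ.μ₅ = 1 :=
    residue_eq_one_of_mul_sq hR 1 (-3) (by linear_combination μ.eq₅)
  exact Descent.mem_iff hR h _ hO'
    ![0, 0, -(6 * μ.μ₄ * μ.μ₅), 6 * μ.μ₄ * 2]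
    ![0, μ.μ₄, 0, 0] ![0, 0, 1, μ.μ₅]
    (by
      simp only [Descent.gens, ofNat_mul_eq_smul (R := R) (B := B)]
      refine Prod.ext ?_ (Prod.ext ?_ ?_) <;> simp
      module)
    (fun i => by
      fin_cases i <;> simp [-IsLocalRing.residue_eq_zero_iff, map_ofNat (residue R), h4, h5] <;> grind)
    hyperplane_eq_span_zero_e₁_sum
    (two_smul_mem_span_of_det (n := 27) (v := 3)
      (by simp only [map_ofNat]; grind)
      (by
        simp only [det3, Matrix.cons_val]
        -- The determinant is `6 μ₄² (μ₅² + 2)`, with `μ₄² = 1/9` and `μ₅² + 2 = 1/3`; this gives `n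
        -- = 27` and `v = 3`.
        linear_combination 6 * (3 * μ.μ₅ ^ 2 + 6) * μ.eq₄ + 6 * μ.eq₅)) p

theorem Descent.CF₁_mem_iff (hR : maximalIdeal R = Ideal.span {2})
    (h : IsOrderBasis O e₁ e₂ e₃)
    (hO' : Subalgebra.toSubmodule O' = Descent.lattice μ e₁ e₂ e₃ Descent.CF₁)
    (p : Fin 4 → R) :
    ofCoords R e₁ e₂ e₃ p ∈ O' ↔ red p ∈ hyperplane 0 1 1 := by
  have := charP_residueField hR
  have h8 : residue R μ.μ₈ = 1 :=
    residue_eq_one_of_mul_sq hR 1 (-267) (by linear_combination μ.eq₈)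
  exact Descent.mem_iff hR h _ hO'
    ![0, 2 * μ.μ₈, -(2 * (3 * μ.μ₈)), -120]
    ![0, 1, 2, 0] ![0, 3, -9, μ.μ₈]
    (by
      simp only [Descent.gens, ofNat_mul_eq_smul (R := R) (B := B)]
      refine Prod.ext ?_ (Prod.ext ?_ ?_) <;> simp <;> module)
    (fun i => by
      fin_cases i <;> simp [-IsLocalRing.residue_eq_zero_iff, map_ofNat (residue R), h8] <;> grind)
    hyperplane_eq_span_zero_e₁_diag
    (two_smul_mem_span_of_det (n := 3) (v := 35)
      (by simp only [map_ofNat]; grind)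
      (by simp only [det3, Matrix.cons_val]; linear_combination 10 * μ.eq₈)) p

theorem Descent.CF₃_mem_iff (hR : maximalIdeal R = Ideal.span {2})
    (h : IsOrderBasis O e₁ e₂ e₃)
    (hO' : Subalgebra.toSubmodule O' = Descent.lattice μ e₁ e₂ e₃ Descent.CF₃)
    (p : Fin 4 → R) :
    ofCoords R e₁ e₂ e₃ p ∈ O' ↔ red p ∈ hyperplane 0 1 1 := by
  have := charP_residueField hR
  have h4 : residue R μ.μ₄ = 1 :=
    residue_eq_one_of_mul_sq hR 4 0 (by linear_combination μ.eq₄)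
  have h5 : residue R μ.μ₅ = 1 :=
    residue_eq_one_of_mul_sq hR 1 (-3) (by linear_combination μ.eq₅)
  exact Descent.mem_iff hR h _ hO'
    ![0, 0, -(6 * μ.μ₄ * μ.μ₅), 6 * μ.μ₄ * 4]
    ![0, μ.μ₄, 0, 0] ![0, 0, 1, μ.μ₅]
    (by
      simp only [Descent.gens, ofNat_mul_eq_smul (R := R) (B := B)]
      refine Prod.ext ?_ (Prod.ext ?_ ?_) <;> simp
      module)
    (fun i => by
      fin_cases i <;> simp [-IsLocalRing.residue_eq_zero_iff, map_ofNat (residue R), h4, h5] <;> grind)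
    hyperplane_eq_span_zero_e₁_sum
    (two_smul_mem_span_of_det (n := 27) (v := 21)
      (by simp only [map_ofNat]; grind)
      (by
        simp only [det3, Matrix.cons_val]
        linear_combination 6 * (3 * μ.μ₅ ^ 2 + 12) * μ.eq₄ + 6 * μ.eq₅)) p

theorem Descent.DD₁_mem_iff (hR : maximalIdeal R = Ideal.span {2})
    (h : IsOrderBasis O e₁ e₂ e₃) {s : ℕ} (hs : 3 ≤ s)
    (hO' : Subalgebra.toSubmodule O' = Descent.lattice μ e₁ e₂ e₃ (Descent.DD₁ s hs))
    (p : Fin 4 → R) :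
    ofCoords R e₁ e₂ e₃ p ∈ O' ↔ red p ∈ hyperplane 1 1 0 := by
  have := charP_residueField hR
  exact Descent.mem_iff hR h _ hO'
    ![0, 1, -5, 0] ![0, 1, 1, 0] ![0, 0, 0, 1]
    (by
      simp only [Descent.gens, ofNat_mul_eq_smul (R := R) (B := B)]
      refine Prod.ext ?_ (Prod.ext ?_ ?_) <;> simp
      module)
    (fun i => by
      fin_cases i <;> simp [-IsLocalRing.residue_eq_zero_iff, map_ofNat (residue R)]
      grind)
    hyperplane_eq_span_sum_sum_e₃
    (two_smul_mem_span_of_det (n := 1) (v := 3)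
      (by simp only [map_ofNat]; grind)
      (by simp only [det3, Matrix.cons_val]; ring)) p

theorem Descent.DD₃_mem_iff (hR : maximalIdeal R = Ideal.span {2})
    (h : IsOrderBasis O e₁ e₂ e₃) {s : ℕ} (hs : 3 ≤ s)
    (hO' : Subalgebra.toSubmodule O' = Descent.lattice μ e₁ e₂ e₃ (Descent.DD₃ s hs))
    (p : Fin 4 → R) :
    ofCoords R e₁ e₂ e₃ p ∈ O' ↔ red p ∈ hyperplane 1 1 0 := by
  have := charP_residueField hR
  have h9 : residue R μ.μ₉ = 1 :=
    residue_eq_one_of_mul_sq hR 7 (-1) (by linear_combination μ.eq₉)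
  exact Descent.mem_iff hR h _ hO'
    ![0, 1, -(5 * μ.μ₉), 0] ![0, μ.μ₉, 1, 0] ![0, 0, 0, 1]
    (by
      simp only [Descent.gens]
      refine Prod.ext ?_ (Prod.ext ?_ ?_) <;> simp
      module)
    (fun i => by
      fin_cases i <;> simp [-IsLocalRing.residue_eq_zero_iff, map_ofNat (residue R), h9]
      grind)
    hyperplane_eq_span_sum_sum_e₃
    (two_smul_mem_span_of_det (n := 3) (v := 1)
      (by simp)
      (by simp only [det3, Matrix.cons_val]; linear_combination μ.eq₉)) p

theorem Descent.EE_mem_iff (hR : maximalIdeal R = Ideal.span {2})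
    (h : IsOrderBasis O e₁ e₂ e₃) {δ s : ℕ} (hδ : δ = 1 ∨ δ = 5) (hs : 3 ≤ s)
    (hO' : Subalgebra.toSubmodule O' = Descent.lattice μ e₁ e₂ e₃ (Descent.EE δ s hδ hs))
    (p : Fin 4 → R) :
    ofCoords R e₁ e₂ e₃ p ∈ O' ↔ red p ∈ hyperplane 0 1 0 := by
  have := charP_residueField hR
  exact Descent.mem_iff hR h _ hO'
    ![0, 0, -2, 0] ![0, 1, 0, 0] ![0, 0, 0, 1]
    (by
      simp only [Descent.gens, ofNat_mul_eq_smul (R := R) (B := B)]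
      refine Prod.ext ?_ (Prod.ext ?_ ?_) <;> simp)
    (fun i => by
      fin_cases i <;> simp [-IsLocalRing.residue_eq_zero_iff, map_ofNat (residue R)]
      grind)
    hyperplane_eq_span_zero_e₁_e₃
    (two_smul_mem_span_of_det (n := 1) (v := 1)
      (by simp)
      (by simp only [det3, Matrix.cons_val]; ring)) p

theorem Descent.EG₁_mem_iff (hR : maximalIdeal R = Ideal.span {2})
    (h : IsOrderBasis O e₁ e₂ e₃)
    (hO' : Subalgebra.toSubmodule O' = Descent.lattice μ e₁ e₂ e₃ Descent.EG₁)
    (p : Fin 4 → R) :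
    ofCoords R e₁ e₂ e₃ p ∈ O' ↔ red p ∈ hyperplane 0 1 1 := by
  have := charP_residueField hR
  exact Descent.mem_iff hR h _ hO'
    ![0, 0, -2, 8] ![0, 1, 0, 0] ![0, 0, 1, 1]
    (by
      simp only [Descent.gens, ofNat_mul_eq_smul (R := R) (B := B)]
      refine Prod.ext ?_ (Prod.ext ?_ ?_) <;> simp)
    (fun i => by
      fin_cases i <;> simp [-IsLocalRing.residue_eq_zero_iff, map_ofNat (residue R)] <;> grind)
    hyperplane_eq_span_zero_e₁_sum
    (two_smul_mem_span_of_det (n := 1) (v := 5)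
      (by simp only [map_ofNat]; grind)
      (by simp only [det3, Matrix.cons_val]; ring)) p

theorem Descent.EG₅_mem_iff (hR : maximalIdeal R = Ideal.span {2})
    (h : IsOrderBasis O e₁ e₂ e₃)
    (hO' : Subalgebra.toSubmodule O' = Descent.lattice μ e₁ e₂ e₃ Descent.EG₅)
    (p : Fin 4 → R) :
    ofCoords R e₁ e₂ e₃ p ∈ O' ↔ red p ∈ hyperplane 0 1 1 := by
  have := charP_residueField hR
  have h6 : residue R μ.μ₆ = 1 :=
    residue_eq_one_of_mul_sq hR 0 (-8) (by linear_combination μ.eq₆)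
  exact Descent.mem_iff hR h _ hO'
    ![0, 0, -(2 * μ.μ₆), 40] ![0, 1, 0, 0] ![0, 0, 1, μ.μ₆]
    (by
      simp only [Descent.gens, ofNat_mul_eq_smul (R := R) (B := B)]
      refine Prod.ext ?_ (Prod.ext ?_ ?_) <;> simp)
    (fun i => by
      fin_cases i <;> simp [-IsLocalRing.residue_eq_zero_iff, map_ofNat (residue R), h6] <;> grind)
    hyperplane_eq_span_zero_e₁_sum
    (two_smul_mem_span_of_det (n := 1) (v := 5)
      (by simp only [map_ofNat]; grind)
      (by simp only [det3, Matrix.cons_val]; linear_combination 2 * μ.eq₆)) p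

theorem Descent.FF_mem_iff (hR : maximalIdeal R = Ideal.span {2})
    (h : IsOrderBasis O e₁ e₂ e₃) {δ s : ℕ} (hδ : δ = 1 ∨ δ = 5) (hs : 4 ≤ s)
    (hO' : Subalgebra.toSubmodule O' = Descent.lattice μ e₁ e₂ e₃ (Descent.FF δ s hδ hs))
    (p : Fin 4 → R) :
    ofCoords R e₁ e₂ e₃ p ∈ O' ↔ red p ∈ hyperplane 0 1 0 := by
  have := charP_residueField hR
  have h10 : residue R μ.μ₁₀ = 1 :=
    residue_eq_one_of_mul_sq hR 3 (-1) (by linear_combination μ.eq₁₀)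
  exact Descent.mem_iff hR h _ hO'
    ![0, 2, -(14 * μ.μ₁₀), 0] ![0, μ.μ₁₀, 2, 0] ![0, 0, 0, 1]
    (by
      simp only [Descent.gens, ofNat_mul_eq_smul (R := R) (B := B)]
      refine Prod.ext ?_ (Prod.ext ?_ ?_) <;> simp
      module)
    (fun i => by
      fin_cases i <;> simp [-IsLocalRing.residue_eq_zero_iff, map_ofNat (residue R), h10] <;> grind)
    hyperplane_eq_span_zero_e₁_e₃
    (two_smul_mem_span_of_det (n := 1) (v := 1)
      (by simp)
      (by simp only [det3, Matrix.cons_val]; linear_combination 2 * μ.eq₁₀)) p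

theorem Descent.GG₁_mem_iff (hR : maximalIdeal R = Ideal.span {2})
    (h : IsOrderBasis O e₁ e₂ e₃) {s : ℕ} (hs : 4 ≤ s)
    (hO' : Subalgebra.toSubmodule O' = Descent.lattice μ e₁ e₂ e₃ (Descent.GG₁ s hs))
    (p : Fin 4 → R) :
    ofCoords R e₁ e₂ e₃ p ∈ O' ↔ red p ∈ hyperplane 0 1 0 := by
  have := charP_residueField hR
  exact Descent.mem_iff hR h _ hO'
    ![0, 0, -10, 0] ![0, 1, 0, 0] ![0, 0, 0, 1]
    (by
      simp only [Descent.gens, ofNat_mul_eq_smul (R := R) (B := B)]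
      refine Prod.ext ?_ (Prod.ext ?_ ?_) <;> simp)
    (fun i => by
      fin_cases i <;> simp [-IsLocalRing.residue_eq_zero_iff, map_ofNat (residue R)]
      grind)
    hyperplane_eq_span_zero_e₁_e₃
    (two_smul_mem_span_of_det (n := 1) (v := 5)
      (by simp only [map_ofNat]; grind)
      (by simp only [det3, Matrix.cons_val]; ring)) p

theorem Descent.GG₅_mem_iff (hR : maximalIdeal R = Ideal.span {2})
    (h : IsOrderBasis O e₁ e₂ e₃) {s : ℕ} (hs : 4 ≤ s)
    (hO' : Subalgebra.toSubmodule O' = Descent.lattice μ e₁ e₂ e₃ (Descent.GG₅ s hs))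
    (p : Fin 4 → R) :
    ofCoords R e₁ e₂ e₃ p ∈ O' ↔ red p ∈ hyperplane 0 1 0 := by
  have := charP_residueField hR
  have h3 : residue R μ.μ₃ = 1 :=
    residue_eq_one_of_mul_sq hR 12 0 (by linear_combination μ.eq₃)
  exact Descent.mem_iff hR h _ hO'
    ![0, 0, -(10 * μ.μ₃), 0] ![0, μ.μ₃, 0, 0] ![0, 0, 0, 1]
    (by
      simp only [Descent.gens]
      refine Prod.ext ?_ (Prod.ext ?_ ?_) <;> simp)
    (fun i => by
      fin_cases i <;> simp [-IsLocalRing.residue_eq_zero_iff, map_ofNat (residue R), h3]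
      grind)
    hyperplane_eq_span_zero_e₁_e₃
    (two_smul_mem_span_of_det (n := 25) (v := 5)
      (by simp only [map_ofNat]; grind)
      (by simp only [det3, Matrix.cons_val]; linear_combination 10 * μ.eq₃)) p


end Descents

/-! ### Reduced forms, and assembly of the cases. -/

section Main

theorem TernaryCoeffs.map_eq {R k : Type*} {φ : R → k} {Q : TernaryCoeffs R} {a b c w : k}
    (ha : φ Q.a = a) (hb : φ Q.b = b) (hc : φ Q.c = c) (hw : φ Q.w = w) :
    Q.map φ = ⟨a, b, c, w⟩ := by
  simp only [TernaryCoeffs.map, ha, hb, hc, hw]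

variable {R : Type*} [CommRing R] [IsLocalRing R]

theorem residue_ofNat_of_even (hR : maximalIdeal R = Ideal.span {2}) (n : ℕ) [n.AtLeastTwo]
    (hn : Even n) : residue R (ofNat(n) : R) = 0 := by
  have := charP_residueField hR
  have h := CharTwo.natCast_eq_ite (R := ResidueField R) n
  rw [if_pos hn] at h
  rw [map_ofNat, ← h]
  rfl

theorem residue_ofNat_of_odd (hR : maximalIdeal R = Ideal.span {2}) (n : ℕ) [n.AtLeastTwo]
    (hn : ¬ Even n) : residue R (ofNat(n) : R) = 1 := by
  have := charP_residueField hR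
  have h := CharTwo.natCast_eq_ite (R := ResidueField R) n
  rw [if_neg hn] at h
  rw [map_ofNat, ← h]
  rfl

theorem residue_two_pow (hR : maximalIdeal R = Ideal.span {2}) {s : ℕ} (hs : 1 ≤ s) :
    residue R (2 ^ s) = 0 := by
  rw [map_pow, residue_two hR, zero_pow (by omega)]

theorem residue_mul_two_pow (hR : maximalIdeal R = Ideal.span {2}) (x : R) {s : ℕ} (hs : 1 ≤ s) :
    residue R (x * 2 ^ s) = 0 := by
  rw [map_mul, residue_two_pow hR hs, mul_zero]

namespace TernaryCoeffs

theorem map_B_zero (hR : maximalIdeal R = Ideal.span {2}) {δ : ℕ} (hδ : δ = 1 ∨ δ = 3) :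
    (ofBassForm R (.B δ 0)).map (residue R) = ⟨1, 1, 1, 0⟩ := by
  refine map_eq (map_one _) (map_one _) ?_ (map_zero _)
  rcases hδ with rfl | rfl
  · simp [ofBassForm]
  · simpa [ofBassForm] using residue_ofNat_of_odd hR 3 (by decide)

theorem map_A1 (hR : maximalIdeal R = Ideal.span {2}) {s : ℕ} (hs : 1 ≤ s) :
    (ofBassForm R (.A1 s)).map (residue R) = ⟨0, 0, 0, 1⟩ :=
  map_eq (map_zero _) (map_zero _) (residue_two_pow hR hs) (map_one _)

theorem map_A2 (hR : maximalIdeal R = Ideal.span {2}) {s : ℕ} (hs : 1 ≤ s) :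
    (ofBassForm R (.A2 s)).map (residue R) = ⟨1, 1, 0, 1⟩ :=
  map_eq (map_one _) (map_one _) (residue_two_pow hR hs) (map_one _)

theorem map_B (hR : maximalIdeal R = Ideal.span {2}) (δ : ℕ) {s : ℕ} (hs : 1 ≤ s) :
    (ofBassForm R (.B δ s)).map (residue R) = ⟨1, 1, 0, 0⟩ :=
  map_eq (map_one _) (map_one _) (residue_mul_two_pow hR _ hs) (map_zero _)

theorem map_C (hR : maximalIdeal R = Ideal.span {2}) (δ : ℕ) {s : ℕ} (hs : 1 ≤ s) :
    (ofBassForm R (.C δ s)).map (residue R) = ⟨1, 0, 0, 0⟩ :=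
  map_eq (map_one _) (residue_ofNat_of_even hR 6 (by decide)) (residue_mul_two_pow hR _ hs)
    (map_zero _)

theorem map_D (hR : maximalIdeal R = Ideal.span {2}) (δ : ℕ) {s : ℕ} (hs : 1 ≤ s) :
    (ofBassForm R (.D δ s)).map (residue R) = ⟨1, 1, 0, 0⟩ :=
  map_eq (map_one _) (residue_ofNat_of_odd hR 5 (by decide)) (residue_mul_two_pow hR _ hs)
    (map_zero _)

theorem map_E (hR : maximalIdeal R = Ideal.span {2}) (δ : ℕ) {s : ℕ} (hs : 1 ≤ s) :
    (ofBassForm R (.E δ s)).map (residue R) = ⟨1, 0, 0, 0⟩ :=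
  map_eq (map_one _) (residue_two hR) (residue_mul_two_pow hR _ hs) (map_zero _)

theorem map_F (hR : maximalIdeal R = Ideal.span {2}) (δ : ℕ) {s : ℕ} (hs : 1 ≤ s) :
    (ofBassForm R (.F δ s)).map (residue R) = ⟨1, 0, 0, 0⟩ :=
  map_eq (map_one _) (residue_ofNat_of_even hR 14 (by decide)) (residue_mul_two_pow hR _ hs)
    (map_zero _)

theorem map_G (hR : maximalIdeal R = Ideal.span {2}) (δ : ℕ) {s : ℕ} (hs : 1 ≤ s) :
    (ofBassForm R (.G δ s)).map (residue R) = ⟨1, 0, 0, 0⟩ :=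
  map_eq (map_one _) (residue_ofNat_of_even hR 10 (by decide)) (residue_mul_two_pow hR _ hs)
    (map_zero _)

end TernaryCoeffs

variable {B : Type*} [Ring B] [Algebra R B] {O O' : Subalgebra R B} {e₁ e₂ e₃ : B} {S : Set R}
  {r : ℕ} {μ : SquareRoots R}

open TernaryCoeffs in
/-- The index of unit groups and the coset representatives, for an order over any local ring with
finite residue field and maximal ideal generated by `2`. -/
theorem Descent.relIndex_and_isRightCosetReps (hR : maximalIdeal R = Ideal.span {2})
    (hr : Nat.card (ResidueField R) = 2 ^ r) (hS : Set.BijOn (residue R) S Set.univ)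
    {f g : BassForm} (D : Descent f g) (hO : IsQuasiGoodBasis f O e₁ e₂ e₃)
    (hO' : Subalgebra.toSubmodule O' = D.lattice μ e₁ e₂ e₃) :
    (unitGroup O').relIndex (unitGroup O) = D.unitIndex (2 ^ r) r ∧
      IsRightCosetReps (unitGroup O') (unitGroup O) (D.unitReps S r e₁ e₂ e₃) := by
  have : Finite (ResidueField R) := Nat.finite_of_card_ne_zero (by rw [hr]; positivity)
  have hb := hO.1
  have h := hO.isCliffordBasis hR
  cases D with
  | A1A2 =>
    have hQ : (ofBassForm R (.A1 0)).map (residue R) = ⟨0, 0, 1, 1⟩ :=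
      map_eq (map_zero _) (map_zero _) (by simp [ofBassForm]) (map_one _)
    simp only [unitIndex, unitReps]
    split_ifs with heven
    · exact h.cosets_matrix_split hR hr heven hQ (A1A2_mem_iff hR hb hO') hS
    · exact h.cosets_matrix_field hR hr heven hQ (A1A2_mem_iff hR hb hO') hS
  | A1A1 s =>
    simp only [unitIndex, unitReps]
    split_ifs with hs
    · subst hs
      exact h.cosets_matrix_borel hR hr (map_eq (map_zero _) (map_zero _) (by simp [ofBassForm])
        (map_one _)) (A1A1_mem_iff hR hb hO') hS
    · exact h.cosets_triangular_e₂ hR hr (map_A1 hR (Nat.one_le_iff_ne_zero.mpr hs))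
        (A1A1_mem_iff hR hb hO') hS
  | A1B => exact h.cosets_triangular_e₃ hR hr (map_A1 hR le_rfl) (A1B_mem_iff hR hb hO') hS
  | A2A2 s hs =>
    exact h.cosets_quadratic_e₁_e₂ hR hr (map_A2 hR hs) (A2A2_mem_iff hR hb hs hO') hS
  | A2B =>
    have key := h.cosets_quadratic_e₃ hR hr (map_A2 hR le_rfl) (A2B_mem_iff hR hb hO') hS
    simp only [unitIndex, unitReps]
    split_ifs with heven
    · simpa only [if_pos heven] using key
    · have := charP_residueField hR
      -- For odd `r` the residue field has no primitive cube root of unity, so the condition on `a`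
      -- is vacuous.
      have hne : ∀ a : R, residue R a ^ 2 + residue R a + 1 ≠ 0 :=
        fun a ha => heven ((exists_primitive_cube_root_iff hr).mp ⟨_, ha⟩)
      simpa only [if_neg heven, hne, true_and, not_false_eq_true, ne_eq] using key
  | BB δ s hδ =>
    simp only [unitIndex, unitReps]
    split_ifs with hs
    · subst hs
      exact h.cosets_klein_e₂ hR hr (map_B_zero hR hδ) (BB_mem_iff hR hb hδ hO') hS
    · exact h.cosets_cyclic_e₂ hR hr (map_B hR δ (Nat.one_le_iff_ne_zero.mpr hs))
        (BB_mem_iff hR hb hδ hO') hS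
  | BC₁ => exact h.cosets_cyclic_e₃ hR hr (map_B hR 1 le_rfl) (BC₁_mem_iff hR hb hO') hS
  | BC₃ => exact h.cosets_cyclic_e₃ hR hr (map_B hR 3 le_rfl) (BC₃_mem_iff hR hb hO') hS
  | BD₁ => exact h.cosets_cyclic_e₂ hR hr (map_B hR 1 (by norm_num)) (BD₁_mem_iff hR hb hO') hS
  | BD₃ => exact h.cosets_cyclic_e₂ hR hr (map_B hR 3 (by norm_num)) (BD₃_mem_iff hR hb hO') hS
  | CC₁ s hs =>
    exact h.cosets_nilpotent_shift_e₂ hR hr (map_C hR 1 hs) (CC₁_mem_iff hR hb hs hO') hS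
  | CC₃ s hs =>
    exact h.cosets_nilpotent_shift_e₂ hR hr (map_C hR 3 hs) (CC₃_mem_iff hR hb hs hO') hS
  | CE₁ =>
    exact h.cosets_nilpotent_shift_e₂ hR hr (map_C hR 1 (by norm_num)) (CE₁_mem_iff hR hb hO') hS
  | CE₃ =>
    exact h.cosets_nilpotent_shift_e₃ hR hr (map_C hR 3 (by norm_num)) (CE₃_mem_iff hR hb hO') hS
  | CF₁ =>
    exact h.cosets_nilpotent_shift_e₂ hR hr (map_C hR 1 (by norm_num)) (CF₁_mem_iff hR hb hO') hS
  | CF₃ =>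
    exact h.cosets_nilpotent_shift_e₃ hR hr (map_C hR 3 (by norm_num)) (CF₃_mem_iff hR hb hO') hS
  | DD₁ s hs =>
    exact h.cosets_cyclic_shift hR hr (map_D hR 1 (by omega)) (DD₁_mem_iff hR hb hs hO') hS
  | DD₃ s hs =>
    exact h.cosets_cyclic_shift hR hr (map_D hR 3 (by omega)) (DD₃_mem_iff hR hb hs hO') hS
  | EE δ s hδ hs =>
    exact h.cosets_nilpotent_shift_e₂ hR hr (map_E hR δ (by omega))
      (EE_mem_iff hR hb hδ hs hO') hS
  | EG₁ =>
    exact h.cosets_nilpotent_shift_e₃ hR hr (map_E hR 1 (by norm_num)) (EG₁_mem_iff hR hb hO') hS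
  | EG₅ =>
    exact h.cosets_nilpotent_shift_e₃ hR hr (map_E hR 5 (by norm_num)) (EG₅_mem_iff hR hb hO') hS
  | FF δ s hδ hs =>
    exact h.cosets_nilpotent_shift_e₂ hR hr (map_F hR δ (by omega))
      (FF_mem_iff hR hb hδ hs hO') hS
  | GG₁ s hs =>
    exact h.cosets_nilpotent_shift_e₂ hR hr (map_G hR 1 (by omega)) (GG₁_mem_iff hR hb hs hO') hS
  | GG₅ s hs =>
    exact h.cosets_nilpotent_shift_e₂ hR hr (map_G hR 5 (by omega)) (GG₅_mem_iff hR hb hs hO') hS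

end Main

end DyadicBass

theorem mainTheorem11
    {K : Type*} [Field K] [NumberField K]
    (v : IsDedekindDomain.HeightOneSpectrum (NumberField.RingOfIntegers K))
    (hv : v.asIdeal = Ideal.span {(2 : NumberField.RingOfIntegers K)})
    (r : ℕ)
    (hr : Nat.card (IsLocalRing.ResidueField (v.adicCompletionIntegers K)) = 2 ^ r)
    {B : Type*} [Ring B] [Algebra (v.adicCompletion K) B]
    [Algebra.IsCentral (v.adicCompletion K) B] [IsSimpleRing B]
    (hB : Module.finrank (v.adicCompletion K) B = 4)
    (μ : DyadicBass.SquareRoots (v.adicCompletionIntegers K))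
    (S : Set (v.adicCompletionIntegers K))
    (hS : Set.BijOn (IsLocalRing.residue (v.adicCompletionIntegers K)) S Set.univ)
    {f g : DyadicBass.BassForm} (D : DyadicBass.Descent f g)
    (O O' : Subalgebra (v.adicCompletionIntegers K) B) (e₁ e₂ e₃ : B)
    (hO : DyadicBass.IsQuasiGoodBasis f O e₁ e₂ e₃)
    (hO' : Subalgebra.toSubmodule O' = D.lattice μ e₁ e₂ e₃) :
    (DyadicBass.unitGroup O').relIndex (DyadicBass.unitGroup O) = D.unitIndex (2 ^ r) r ∧
      DyadicBass.IsRightCosetReps (DyadicBass.unitGroup O') (DyadicBass.unitGroup O)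
        (D.unitReps S r e₁ e₂ e₃) := by
  exact D.relIndex_and_isRightCosetReps
    (DyadicBass.maximalIdeal_adicCompletionIntegers_eq_span_two v hv) hr hS hO hO'
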